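/- **Model.** Let $X$ be a finite data domain. In the $(m,n)$-hybrid model a curator holds $m$ points of $X$, each of $n$ local agents holds one point of $X$, and a referee holds no input. All parties toss independent private coins; messages (elements of a countable set, e.g. finite bit strings) are exchanged only between the referee and the other parties, and each message depends on the sender's input, its coins and the messages it has received so far. At the end the referee writes an output. In one *exchange with the curator* the referee sends a message to the curator and receives an answer; in one *exchange with the agents* the referee simultaneously sends a message to each agent and receives an answer from each. For $n=0$ (only exchanges with the curator) this is the trusted curator model; for $m=0$ (only exchanges with the agents) it is the local model, and the number of rounds is the number of exchanges. The protocol is $\varepsilon$-differentially private if for the curator and for every agent $P$, every randomized adversary $A$ that replaces all other parties and may send arbitrary messages to $P$, all inputs $\mathbf x,\mathbf x'$ of $P$ differing in at most one entry, and every event $S$, $\Pr[A \text{ interacting with } P(\mathbf x)\text{ outputs an element of } S]\le e^{\varepsilon}\Pr[A \text{ interacting with } P(\mathbf x')\text{ outputs an element of } S]$. **Task.** Let $c,d,m$ be natural numbers. The 1-out-of-$2^d$-parity task with strings of length $c$ is given by strings $r_j\in\{0,1\}^c$ for $j\in\{0,1\}^d$ and by $s_1,\dots,s_{m+1}\in\{0,1\}^d$;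 put $s=s_1\oplus\cdots\oplus s_{m+1}$. Each input point is generated independently as follows: with probability $1/2$ it is $(x,(\langle x,r_j\rangle)_{j\in\{0,1\}^d})$ for a uniform $x\in\{0,1\}^c$ (inner products modulo 2), and with probability $1/2$ it is $(t,s_t)$ for a uniform $t\in\{1,\dots,m+1\}$. A protocol solves the task with error $\beta$ if for all $(r_j)_j$ and $s_1,\dots,s_{m+1}$ the referee outputs $r_s$ with probability at least $1-\beta$ over the input points and the coins of all parties. **Theorem.** Let $\varepsilon=\beta=1/4$. For every integer $c\ge1$ there are natural numbers $d=d(c)$, $m=m(c)$, $n=n(c)$, with $d=\Theta(\log c)$, $m=\Theta(c)$ and $n=\Theta(c^2\log c)$ (uniformly over $c\ge2$), such that: 1. There is an $\varepsilon$-differentially private protocol in the $(m,n)$-hybrid model that solves the 1-out-of-$2^d$-parity task with strings of length $c$ with error $\beta$, in which first each local agent sends one message to the referee (without receiving any information) and then the referee makes one exchange with the curator. 2. There is no $\varepsilon$-differentially private protocol in the $(m,n)$-hybrid model that solves this task with error $\beta$ in which the referee first makes any number of exchanges with the curator and then a single exchange with the agents. 3. In every $\varepsilon$-differentially private protocol in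 the local model with $n$ agents that solves this task with error $\beta$, the number of rounds is $2^{\Omega(c)}$ and $2^{\Omega(\sqrt{n/\log n})}$: there is a constant $\gamma>0$ such that for all sufficiently large $c$ the number of rounds is at least $2^{\gamma c}$ and at least $2^{\gamma\sqrt{n/\log n}}$. 4. No algorithm in the trusted curator model with $m$ input points, private or not, solves this task with error $\beta$. -/

import Mathlib

open MeasureTheory Filter Asymptotics
open scoped ENNReal

namespace HybridDP

/-- A party holding `ℓ` points of the data domain `X`, as an interactive randomized functionality.
It tosses its private coins once; whenever it receives a message it answers with a message that
is determined by its input, its coins, and the list of all messages received so far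
(the most recent one last). -/
structure Party (X : Type) (ℓ : ℕ) (Msg : Type) where
  Coins : Type
  [coinsMeasurableSpace : MeasurableSpace Coins]
  law : Measure Coins
  [isProbabilityMeasure : IsProbabilityMeasure law]
  reply : (Fin ℓ → X) → Coins → List Msg → Msg
  measurableSet_reply : ∀ x h v, MeasurableSet {ω | reply x ω h = v}

attribute [instance] Party.coinsMeasurableSpace Party.isProbabilityMeasure

/-- An adversary that controls everybody except one party: a randomized strategy which chooses the
next message from its coins and the answers received so far, and finally writes an output.
It need not follow any protocol. -/
structure Adversary (Msg : Type) where
  Coins : Type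
  [coinsMeasurableSpace : MeasurableSpace Coins]
  law : Measure Coins
  [isProbabilityMeasure : IsProbabilityMeasure law]
  Out : Type
  [outMeasurableSpace : MeasurableSpace Out]
  query : Coins → List Msg → Msg
  output : Coins → List Msg → Out
  measurableSet_query : ∀ h v, MeasurableSet {ω | query ω h = v}
  measurable_output : ∀ h, Measurable fun ω => output ω h

attribute [instance] Adversary.coinsMeasurableSpace Adversary.isProbabilityMeasure
  Adversary.outMeasurableSpace

/-- `k` exchanges between a party (input `x`, coins `ω`) and the deterministic strategy `A`:
the messages received by the party and the answers it gives, in chronological order. -/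
def Party.interact {X Msg : Type} {ℓ : ℕ} (P : Party X ℓ Msg) (x : Fin ℓ → X) (ω : P.Coins)
    (A : List Msg → Msg) : ℕ → List Msg × List Msg
  | 0 => ([], [])
  | k + 1 =>
    let h := P.interact x ω A k
    let received := h.1 ++ [A h.2]
    (received, h.2 ++ [P.reply x ω received])

/-- The probability that the adversary `A`, after `T` exchanges with the party `P` on input `x`,
has an output in `S`. -/
noncomputable def Adversary.outputProb {X Msg : Type} {ℓ : ℕ} (A : Adversary Msg)
    (P : Party X ℓ Msg) (T : ℕ) (x : Fin ℓ → X) (S : Set A.Out) : ℝ≥0∞ :=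
  (A.law.prod P.law) {ω | A.output ω.1 (P.interact x ω.2 (A.query ω.1) T).2 ∈ S}

/-- Two databases are neighboring if they differ in at most one entry. -/
def Neighboring {X : Type} {ℓ : ℕ} (x x' : Fin ℓ → X) : Prop :=
  x = x' ∨ ∃ i, ∀ j, j ≠ i → x j = x' j

/-- A party that takes part in `T` exchanges is `ε`-differentially private: whatever the other
parties do, their output distributions on neighboring inputs are `(ε, 0)`-close.
(Both directions are covered because `Neighboring` is symmetric.) -/
def Party.IsPrivate {X Msg : Type} {ℓ : ℕ} (P : Party X ℓ Msg) (T : ℕ) (ε : ℝ) : Prop :=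
  ∀ (A : Adversary Msg) (x x' : Fin ℓ → X), Neighboring x x' →
    ∀ S : Set A.Out, MeasurableSet S →
      A.outputProb P T x S ≤ ENNReal.ofReal (Real.exp ε) * A.outputProb P T x' S

/-- One exchange of messages: in a `curator` round the referee sends a message to the curator and
gets an answer; in an `agents` round it simultaneously sends a message to each local agent and gets
an answer from each of them. -/
inductive Round
  | curator
  | agents
deriving DecidableEq

/-- A protocol in the `(m, n)`-hybrid model over the data domain `X` whose exchanges follow the
schedule `σ`, and in which the referee writes an output in `Y`. Messages come from a countable set
(for example, finite bit strings); the coins come from arbitrary probability spaces. The referee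
sees the answers received so far: `Sum.inl` for the curator, `Sum.inr` for all agents. -/
structure Protocol (X Y : Type) (σ : List Round) (m n : ℕ) where
  Msg : Type
  [countable_msg : Countable Msg]
  curator : Party X m Msg
  agent : Fin n → Party X 1 Msg
  RefCoins : Type
  [refCoinsMeasurableSpace : MeasurableSpace RefCoins]
  refLaw : Measure RefCoins
  [isProbabilityMeasure : IsProbabilityMeasure refLaw]
  toCurator : RefCoins → List (Msg ⊕ (Fin n → Msg)) → Msg
  toAgent : RefCoins → List (Msg ⊕ (Fin n → Msg)) → Fin n → Msg
  output : RefCoins → List (Msg ⊕ (Fin n → Msg)) → Y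
  measurableSet_toCurator : ∀ h v, MeasurableSet {ω | toCurator ω h = v}
  measurableSet_toAgent : ∀ h i v, MeasurableSet {ω | toAgent ω h i = v}
  measurableSet_output : ∀ h v, MeasurableSet {ω | output ω h = v}

attribute [instance] Protocol.countable_msg Protocol.refCoinsMeasurableSpace
  Protocol.isProbabilityMeasure

namespace Protocol

variable {X Y : Type} {σ : List Round} {m n : ℕ}

/-- The coins of the referee, of the curator and of the agents. -/
abbrev Coins (P : Protocol X Y σ m n) : Type :=
  P.RefCoins × P.curator.Coins × (∀ i, (P.agent i).Coins)

/-- All parties toss their coins independently. -/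
noncomputable def coinLaw (P : Protocol X Y σ m n) : Measure P.Coins :=
  P.refLaw.prod (P.curator.law.prod (Measure.pi fun i => (P.agent i).law))

/-- Run the schedule `τ` on curator input `x`, agent inputs `y` and coins `ω`, starting from
the messages `hc` received so far by the curator, the messages `ha i` received so far by agent `i`,
and the answers `view` received so far by the referee; the value is the final view of
the referee. -/
def run (P : Protocol X Y σ m n) (x : Fin m → X) (y : Fin n → X) (ω : P.Coins) :
    List Round → List P.Msg → (Fin n → List P.Msg) → List (P.Msg ⊕ (Fin n → P.Msg)) →
      List (P.Msg ⊕ (Fin n → P.Msg))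
  | [], _, _, view => view
  | .curator :: τ, hc, ha, view =>
    let hc' := hc ++ [P.toCurator ω.1 view]
    P.run x y ω τ hc' ha (view ++ [Sum.inl (P.curator.reply x ω.2.1 hc')])
  | .agents :: τ, hc, ha, view =>
    let ha' := fun i => ha i ++ [P.toAgent ω.1 view i]
    P.run x y ω τ hc ha'
      (view ++ [Sum.inr fun i => (P.agent i).reply (fun _ => y i) (ω.2.2 i) (ha' i)])

/-- The output of the referee as a function of all inputs and coins. -/
def result (P : Protocol X Y σ m n) (x : Fin m → X) (y : Fin n → X) (ω : P.Coins) : Y :=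
  P.output ω.1 (P.run x y ω σ [] (fun _ => []) [])

/-- The probability, over the coins of all parties, that the referee outputs `v`. -/
noncomputable def outputProb (P : Protocol X Y σ m n) (x : Fin m → X) (y : Fin n → X) (v : Y) :
    ℝ≥0∞ :=
  P.coinLaw {ω | P.result x y ω = v}

/-- `ε`-differential privacy against a malicious coalition of all parties but one. Each party
takes part in as many exchanges as the schedule prescribes. The referee has no input. -/
def IsPrivate (P : Protocol X Y σ m n) (ε : ℝ) : Prop :=
  P.curator.IsPrivate (σ.count .curator) ε ∧ ∀ i, (P.agent i).IsPrivate (σ.count .agents) ε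

/-- The agents' messages do not depend on the contents of any message that they receive: for a
schedule with a single `agents` round, each agent just sends one message to the referee. -/
def AgentsIgnoreMessages (P : Protocol X Y σ m n) : Prop :=
  ∀ i y ω (h h' : List P.Msg), h.length = h'.length →
    (P.agent i).reply y ω h = (P.agent i).reply y ω h'

end Protocol

/-- Bit strings of length `k`; addition is bitwise exclusive or. -/
abbrev Bits (k : ℕ) : Type := Fin k → ZMod 2

/-- The data domain of the 1-out-of-`2^d`-parity task with strings of length `c` and `k` shares:
points `(x, (b_j)_j)` and points `(t, s_t)`. -/
abbrev Point (c d k : ℕ) : Type := (Bits c × (Bits d → ZMod 2)) ⊕ (Fin k × Bits d)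

/-- The distribution of one sample, for the strings `r` and the shares `s` (`k + 1` of them). -/
noncomputable def sampleLaw {c d k : ℕ} (r : Bits d → Bits c) (s : Fin (k + 1) → Bits d) :
    PMF (Point c d (k + 1)) :=
  (PMF.uniformOfFintype Bool).bind fun b =>
    if b then
      (PMF.uniformOfFintype (Bits c)).map fun x => Sum.inl (x, fun j => x ⬝ᵥ r j)
    else
      (PMF.uniformOfFintype (Fin (k + 1))).map fun t => Sum.inr (t, s t)

/-- The referee recovers `r_s`, where `s` is the exclusive or of the `k + 1` shares, with
probability at least `1 - β` over the `m + n` independent samples and the coins of the parties,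
for all strings `r` and all shares `s`. -/
def SolvesOneOutOfParity {c d k m n : ℕ} {σ : List Round}
    (P : Protocol (Point c d (k + 1)) (Bits c) σ m n) (β : ℝ) : Prop :=
  ∀ (r : Bits d → Bits c) (s : Fin (k + 1) → Bits d),
    ENNReal.ofReal (1 - β) ≤
      ∑ x : Fin m → Point c d (k + 1), ∑ y : Fin n → Point c d (k + 1),
        (∏ i, sampleLaw r s (x i)) * (∏ i, sampleLaw r s (y i)) *
          P.outputProb x y (r (∑ t, s t))

end HybridDP

/-! For fixed coins of the referee, all messages sent to the parties can be read off the referee's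
view. The event of a given view is therefore a product event in the coins of the curator and of the
agents (`revRun_eq_iff`, `partyLaw_revRun`). Privacy, tested with an adversary that replays one
fixed transcript, bounds how much each factor changes with the input (`law_consistent_le`).

Positive part. Each agent answers with a random sign table that is slightly biased at its share, if
it holds one. A Chernoff argument decodes all shares from order `c ^ 2 * log c` tables
(`one_le_sum_decode`). The curator then runs the exponential mechanism for a single string, and
order `c` samples suffice against `2 ^ c` candidates (`one_le_sum_expMechanism`).

Curator alone or first. By pigeonhole `m` samples miss one of the `m + 1` shares, so the curator's
data leave the secret index uniform. Alone, the curator then succeeds with probability at most `1 /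
2` for suitable strings. If the agents are asked once, after the curator, their queries are fixed
before any agent answers. Agents with share points know nothing about the strings, so their answers
can be simulated for every value of the missing share. The answers of the curator and of the other
agents thus yield guesses for all `2 ^ d` strings at once. By privacy the law of these answers is
within a factor `exp ((m + n) / 4)` of a law that does not depend on the strings. A fixed table of
guesses, however, is right in more than five eighths of the places only for an exponentially small
(in `2 ^ d`) fraction of the strings (`card_agree_le`), and `2 ^ d` is chosen larger than `16 * (m +
n)`.

Local model. Averaged over the samples, the probability of a transcript is a product over the
agents. Random strings give pairwise independent labels to distinct points, so each private factor
has relative variance at most `2 ^ (-c)` (`sum_sq_answer_le`). If `16 * (n + 1) ^ 2 ≤ 2 ^ c`, a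
transcript is therefore almost uninformative, whatever the number of rounds. For the chosen `n` and
large `c` no private local protocol exists at all, and the bounds on the number of rounds hold
vacuously. -/

namespace HybridDP

/-! ### Privacy as a pointwise bound on transcripts of one party -/

section Consistent

variable {X Msg : Type} {ℓ : ℕ}

/-- The coins with which a party on input `x` produces the given log of pairs (message received,
answer given), the most recent pair first. -/
def Party.consistent (P : Party X ℓ Msg) (x : Fin ℓ → X) : List (Msg × Msg) → Set P.Coins
  | [] => Set.univ
  | p :: L => P.consistent x L ∩ {ω | P.reply x ω ((p :: L).map Prod.fst).reverse = p.2}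

theorem Party.measurableSet_consistent (P : Party X ℓ Msg) (x : Fin ℓ → X)
    (L : List (Msg × Msg)) : MeasurableSet (P.consistent x L) := by
  induction L with
  | nil => exact MeasurableSet.univ
  | cons p L ih => exact ih.inter (P.measurableSet_reply _ _ _)

theorem Party.length_interact_snd (P : Party X ℓ Msg) (x : Fin ℓ → X) (ω : P.Coins)
    (A : List Msg → Msg) (k : ℕ) : (P.interact x ω A k).2.length = k := by
  induction k with
  | zero => rfl
  | succ k ih => simp [Party.interact, ih]

/-- A strategy that only counts the answers and sends the logged messages makes the received
messages independent of the coins; the answers alone then decide consistency. -/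
theorem Party.interact_eq_iff (P : Party X ℓ Msg) (x : Fin ℓ → X) (ω : P.Coins)
    (A : List Msg → Msg) (L : List (Msg × Msg))
    (hA : ∀ p K, (p :: K) <:+ L → ∀ h : List Msg, h.length = K.length → A h = p.1) :
    (P.interact x ω A L.length).1 = (L.map Prod.fst).reverse ∧
      ((P.interact x ω A L.length).2 = (L.map Prod.snd).reverse ↔ ω ∈ P.consistent x L) := by
  induction L with
  | nil => simp [Party.interact, Party.consistent]
  | cons p L ih =>
    obtain ⟨ih1, ih2⟩ := ih fun q K hK => hA q K (hK.trans (List.suffix_cons p L))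
    have hq : A (P.interact x ω A L.length).2 = p.1 :=
      hA p L (List.suffix_refl _) _ (P.length_interact_snd x ω A _)
    have h1 : (P.interact x ω A (p :: L).length).1 = ((p :: L).map Prod.fst).reverse := by
      simp [Party.interact, ih1, hq]
    refine ⟨h1, ?_⟩
    have h2 : (P.interact x ω A (p :: L).length).2 = (P.interact x ω A L.length).2 ++
        [P.reply x ω ((p :: L).map Prod.fst).reverse] := by
      rw [← h1]; rfl
    rw [h2, List.map_cons (f := Prod.snd), List.reverse_cons, Party.consistent, Set.mem_inter_iff,
      ← ih2, Set.mem_ofPred_eq]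
    constructor
    · intro h
      have := List.append_inj' h rfl
      exact ⟨this.1, by simpa using this.2⟩
    · rintro ⟨ha, hb⟩
      rw [ha, hb]

/-- An adversary that sends the messages of a fixed log and tests whether the answers agree. -/
noncomputable def Adversary.replay (q a : List Msg) (v : Msg) : Adversary Msg where
  Coins := Unit
  law := Measure.dirac ()
  Out := Prop
  query _ h := (q[h.length]?).getD v
  output _ h := h = a
  measurableSet_query _ _ := MeasurableSet.of_discrete
  measurable_output _ := measurable_const

theorem Party.IsPrivate.law_consistent_le {P : Party X ℓ Msg} {T : ℕ} {ε : ℝ}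
    (hP : P.IsPrivate T ε) {x x' : Fin ℓ → X} (hx : Neighboring x x') {L : List (Msg × Msg)}
    (hL : L.length = T) :
    P.law (P.consistent x L) ≤ ENNReal.ofReal (Real.exp ε) * P.law (P.consistent x' L) := by
  -- Some message is needed as a default for queries beyond the log; within `T` exchanges it is
  -- never sent.
  obtain ⟨ω₀⟩ : Nonempty P.Coins := P.law.nonempty_of_neZero
  let A := Adversary.replay (L.map Prod.fst).reverse (L.map Prod.snd).reverse (P.reply x ω₀ [])
  have key : ∀ z, A.outputProb P T z ({True} : Set Prop) = P.law (P.consistent z L) := by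
    intro z
    have hset : {ω : A.Coins × P.Coins | A.output ω.1 (P.interact z ω.2 (A.query ω.1) T).2 ∈
        ({True} : Set Prop)} = Set.univ ×ˢ P.consistent z L := by
      ext ⟨u, ω⟩
      have hq : ∀ p K, (p :: K) <:+ L → ∀ h : List Msg, h.length = K.length →
          A.query u h = p.1 := by
        rintro p K ⟨K', rfl⟩ h hh
        change (((K' ++ p :: K).map Prod.fst).reverse[h.length]?).getD _ = p.1
        simp [hh]
      have := (P.interact_eq_iff z ω (A.query u) L hq).2
      rw [hL] at this
      rw [Set.mem_prod, ← this]
      change ((P.interact z ω (A.query u) T).2 = (L.map Prod.snd).reverse) ∈ ({True} : Set Prop) ↔ _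
      simp
    refine (congrArg (A.law.prod P.law) hset).trans ?_
    rw [Measure.prod_prod, measure_univ, one_mul]
  rw [← key x, ← key x']
  exact hP A x x' hx _ trivial

theorem Party.IsPrivate.law_consistent_le_pow {P : Party X ℓ Msg} {T : ℕ} {ε : ℝ}
    (hP : P.IsPrivate T ε) (x x' : Fin ℓ → X) {L : List (Msg × Msg)} (hL : L.length = T) :
    P.law (P.consistent x L) ≤
      ENNReal.ofReal (Real.exp ε) ^ ℓ * P.law (P.consistent x' L) := by
  -- Group privacy by hybrids: the first `k` entries come from `x'`, and each increment of `k`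
  -- changes one entry and costs one factor.
  have key : ∀ k ≤ ℓ, P.law (P.consistent x L) ≤ ENNReal.ofReal (Real.exp ε) ^ k *
      P.law (P.consistent (fun i => if (i : ℕ) < k then x' i else x i) L) := by
    intro k
    induction k with
    | zero => simp
    | succ k ih =>
      intro hk
      refine (ih (by omega)).trans ?_
      rw [pow_succ, mul_assoc]
      gcongr
      refine hP.law_consistent_le (Or.inr ⟨⟨k, hk⟩, fun j hj => ?_⟩) hL
      have : (j : ℕ) ≠ k := fun h => hj (Fin.ext h)
      by_cases h : (j : ℕ) < k
      · simp [h, Nat.lt_succ_of_lt h]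
      · have h' : ¬ (j : ℕ) < k + 1 := by omega
        simp [h, h']
  have := key ℓ le_rfl
  simpa using this

end Consistent

/-! ### Views of the referee and their product-form probabilities -/

namespace Protocol

variable {X Y : Type} {σ : List Round} {m n : ℕ}

/-- What the referee has received, the most recent answer first. -/
abbrev View (P : Protocol X Y σ m n) : Type := List (P.Msg ⊕ (Fin n → P.Msg))

/-- The exchanges with the curator in a (reversed) view. -/
def curatorLog (P : Protocol X Y σ m n) (ρ : P.RefCoins) : P.View → List (P.Msg × P.Msg)
  | [] => []
  | .inl a :: B => (P.toCurator ρ B.reverse, a) :: P.curatorLog ρ B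
  | .inr _ :: B => P.curatorLog ρ B

/-- The exchanges with the `i`-th agent in a (reversed) view. -/
def agentLog (P : Protocol X Y σ m n) (ρ : P.RefCoins) (i : Fin n) :
    P.View → List (P.Msg × P.Msg)
  | [] => []
  | .inl _ :: B => P.agentLog ρ i B
  | .inr b :: B => (P.toAgent ρ B.reverse i, b i) :: P.agentLog ρ i B

/-- The rounds in which the answers of a view were received. -/
def shape (P : Protocol X Y σ m n) (B : P.View) : List Round :=
  B.map (Sum.elim (fun _ => .curator) fun _ => .agents)

theorem length_curatorLog (P : Protocol X Y σ m n) (ρ : P.RefCoins) (B : P.View) :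
    (P.curatorLog ρ B).length = (P.shape B).count .curator := by
  induction B with
  | nil => rfl
  | cons b B ih => cases b <;> simp [curatorLog, shape] <;> simpa [shape] using ih

theorem length_agentLog (P : Protocol X Y σ m n) (ρ : P.RefCoins) (i : Fin n) (B : P.View) :
    (P.agentLog ρ i B).length = (P.shape B).count .agents := by
  induction B with
  | nil => rfl
  | cons b B ih => cases b <;> simp [agentLog, shape] <;> simpa [shape] using ih

/-- `run` with all lists reversed, including the schedule. -/
def revRun (P : Protocol X Y σ m n) (x : Fin m → X) (y : Fin n → X) (ω : P.Coins) :
    List Round → P.View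
  | [] => []
  | .curator :: τ =>
    let B := P.revRun x y ω τ
    .inl (P.curator.reply x ω.2.1
      (P.toCurator ω.1 B.reverse :: (P.curatorLog ω.1 B).map Prod.fst).reverse) :: B
  | .agents :: τ =>
    let B := P.revRun x y ω τ
    .inr (fun i => (P.agent i).reply (fun _ => y i) (ω.2.2 i)
      (P.toAgent ω.1 B.reverse i :: (P.agentLog ω.1 i B).map Prod.fst).reverse) :: B

/-- The induction needs a start in the middle of the execution: `τ'` is the part of the schedule
already carried out, most recent round first, and the logs of its view supply what every party has
received so far. -/
theorem run_eq_revRun (P : Protocol X Y σ m n) (x : Fin m → X) (y : Fin n → X) (ω : P.Coins)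
    (τ τ' : List Round) :
    P.run x y ω τ ((P.curatorLog ω.1 (P.revRun x y ω τ')).map Prod.fst).reverse
        (fun i => ((P.agentLog ω.1 i (P.revRun x y ω τ')).map Prod.fst).reverse)
        (P.revRun x y ω τ').reverse =
      (P.revRun x y ω (τ.reverse ++ τ')).reverse := by
  induction τ generalizing τ' with
  | nil => rfl
  | cons a τ ih =>
    cases a
    · have := ih (.curator :: τ')
      simp only [List.reverse_cons, List.append_assoc, List.singleton_append]
      rw [← this]
      simp [run, revRun, curatorLog, agentLog]
    · have := ih (.agents :: τ')
      simp only [List.reverse_cons, List.append_assoc, List.singleton_append]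
      rw [← this]
      simp [run, revRun, curatorLog, agentLog]

theorem result_eq (P : Protocol X Y σ m n) (x : Fin m → X) (y : Fin n → X) (ω : P.Coins) :
    P.result x y ω = P.output ω.1 (P.revRun x y ω σ.reverse).reverse := by
  have := P.run_eq_revRun x y ω σ []
  simp only [revRun, curatorLog, agentLog, List.map_nil, List.reverse_nil, List.append_nil] at this
  rw [result, this]

theorem shape_revRun (P : Protocol X Y σ m n) (x : Fin m → X) (y : Fin n → X) (ω : P.Coins)
    (τ : List Round) : P.shape (P.revRun x y ω τ) = τ := by
  induction τ with
  | nil => rfl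
  | cons a τ ih => cases a <;> simpa [revRun, shape] using ih

/-- Once the referee's coins and the view are fixed, every query is determined, so each party's
answers constrain only that party's own coins. This is the source of all product formulas. -/
theorem revRun_eq_iff (P : Protocol X Y σ m n) (x : Fin m → X) (y : Fin n → X) (ω : P.Coins)
    (B : P.View) :
    P.revRun x y ω (P.shape B) = B ↔ ω.2.1 ∈ P.curator.consistent x (P.curatorLog ω.1 B) ∧
      ∀ i, ω.2.2 i ∈ (P.agent i).consistent (fun _ => y i) (P.agentLog ω.1 i B) := by
  induction B with
  | nil => simp [revRun, shape, Party.consistent, curatorLog, agentLog]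
  | cons b B ih =>
    cases b with
    | inl a =>
      have hs : P.shape (.inl a :: B) = .curator :: P.shape B := rfl
      rw [hs]
      simp only [revRun, List.cons.injEq, curatorLog, agentLog, Party.consistent,
        Set.mem_inter_iff, Set.mem_ofPred_eq, List.map_cons, Sum.inl.injEq]
      constructor
      · rintro ⟨h1, h2⟩
        rw [h2] at h1
        exact ⟨⟨(ih.1 h2).1, h1⟩, (ih.1 h2).2⟩
      · rintro ⟨⟨h1, h2⟩, h3⟩
        have h := ih.2 ⟨h1, h3⟩
        rw [h]
        exact ⟨h2, rfl⟩
    | inr b =>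
      have hs : P.shape (.inr b :: B) = .agents :: P.shape B := rfl
      rw [hs]
      simp only [revRun, List.cons.injEq, curatorLog, agentLog, Party.consistent,
        Set.mem_inter_iff, Set.mem_ofPred_eq, List.map_cons, Sum.inr.injEq]
      constructor
      · rintro ⟨h1, h2⟩
        rw [h2] at h1
        exact ⟨(ih.1 h2).1, fun i => ⟨(ih.1 h2).2 i, congrFun h1 i⟩⟩
      · rintro ⟨h1, h2⟩
        have h := ih.2 ⟨h1, fun i => (h2 i).1⟩
        rw [h]
        exact ⟨funext fun i => (h2 i).2, rfl⟩

theorem measurableSet_curatorLog (P : Protocol X Y σ m n) (B : P.View) (L : List (P.Msg × P.Msg)) :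
    MeasurableSet {ρ | P.curatorLog ρ B = L} := by
  induction B generalizing L with
  | nil => simp [curatorLog]
  | cons b B ih =>
    cases b with
    | inr b => exact ih L
    | inl a =>
      cases L with
      | nil => simp [curatorLog]
      | cons p L =>
        have : {ρ | P.curatorLog ρ (.inl a :: B) = p :: L} =
            ({ρ | P.toCurator ρ B.reverse = p.1} ∩ {_ρ | a = p.2}) ∩
              {ρ | P.curatorLog ρ B = L} := by
          ext ρ; simp [curatorLog, Prod.ext_iff]
        rw [this]
        exact ((P.measurableSet_toCurator _ _).inter (MeasurableSet.const _)).inter (ih L)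

theorem measurableSet_agentLog (P : Protocol X Y σ m n) (i : Fin n) (B : P.View)
    (L : List (P.Msg × P.Msg)) : MeasurableSet {ρ | P.agentLog ρ i B = L} := by
  induction B generalizing L with
  | nil => simp [agentLog]
  | cons b B ih =>
    cases b with
    | inl a => exact ih L
    | inr b =>
      cases L with
      | nil => simp [agentLog]
      | cons p L =>
        have : {ρ | P.agentLog ρ i (.inr b :: B) = p :: L} =
            ({ρ | P.toAgent ρ B.reverse i = p.1} ∩ {_ρ | b i = p.2}) ∩
              {ρ | P.agentLog ρ i B = L} := by
          ext ρ; simp [agentLog, Prod.ext_iff]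
        rw [this]
        exact ((P.measurableSet_toAgent _ _ _).inter (MeasurableSet.const _)).inter (ih L)

theorem measurableSet_revRun (P : Protocol X Y σ m n) (x : Fin m → X) (y : Fin n → X)
    (B : P.View) : MeasurableSet {ω : P.Coins | P.revRun x y ω (P.shape B) = B} := by
  -- The logs depend on the referee's coins; splitting over the countably many possible logs leaves
  -- rectangles.
  have : {ω : P.Coins | P.revRun x y ω (P.shape B) = B} =
      (⋃ L, {ω : P.Coins | P.curatorLog ω.1 B = L} ∩
        {ω | ω.2.1 ∈ P.curator.consistent x L}) ∩
      ⋂ i, ⋃ L, {ω : P.Coins | P.agentLog ω.1 i B = L} ∩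
        {ω | ω.2.2 i ∈ (P.agent i).consistent (fun _ => y i) L} := by
    ext ω
    simp [revRun_eq_iff]
  rw [this]
  refine (MeasurableSet.iUnion fun L => ?_).inter
    (MeasurableSet.iInter fun i => MeasurableSet.iUnion fun L => ?_)
  · exact (measurable_fst (P.measurableSet_curatorLog B L)).inter
      ((measurable_fst.comp measurable_snd) (P.curator.measurableSet_consistent x L))
  · exact (measurable_fst (P.measurableSet_agentLog i B L)).inter
      (((measurable_pi_apply i).comp (measurable_snd.comp measurable_snd))
        ((P.agent i).measurableSet_consistent _ L))

theorem measurableSet_revRun_eq (P : Protocol X Y σ m n) (x : Fin m → X) (y : Fin n → X)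
    (τ : List Round) (B : P.View) : MeasurableSet {ω : P.Coins | P.revRun x y ω τ = B} := by
  by_cases h : P.shape B = τ
  · subst h; exact P.measurableSet_revRun x y B
  · convert MeasurableSet.empty
    ext ω
    simp only [Set.mem_ofPred_eq, Set.mem_empty_iff_false, iff_false]
    rintro rfl
    exact h (P.shape_revRun x y ω τ)

theorem measurableSet_result (P : Protocol X Y σ m n) (x : Fin m → X) (y : Fin n → X) (v : Y) :
    MeasurableSet {ω : P.Coins | P.result x y ω = v} := by
  have : {ω : P.Coins | P.result x y ω = v} = ⋃ B : P.View,
      {ω : P.Coins | P.revRun x y ω σ.reverse = B} ∩ {ω | P.output ω.1 B.reverse = v} := by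
    ext ω
    simp [result_eq]
  rw [this]
  exact MeasurableSet.iUnion fun B => (P.measurableSet_revRun_eq x y _ B).inter
    (measurable_fst (P.measurableSet_output _ _))

/-- The law of the coins of the curator and of the agents. -/
noncomputable abbrev partyLaw (P : Protocol X Y σ m n) :
    Measure (P.curator.Coins × (∀ i, (P.agent i).Coins)) :=
  P.curator.law.prod (Measure.pi fun i => (P.agent i).law)

instance (P : Protocol X Y σ m n) : IsProbabilityMeasure P.coinLaw := by
  unfold coinLaw; infer_instance

theorem outputProb_eq_lintegral (P : Protocol X Y σ m n) (x : Fin m → X) (y : Fin n → X) (v : Y) :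
    P.outputProb x y v = ∫⁻ ρ, P.partyLaw {ω | P.result x y (ρ, ω) = v} ∂P.refLaw := by
  rw [outputProb, coinLaw, Measure.prod_apply (P.measurableSet_result x y v)]
  rfl

theorem outputProb_add_le (P : Protocol X Y σ m n) (x : Fin m → X) (y : Fin n → X) {v w : Y}
    (h : v ≠ w) : P.outputProb x y v + P.outputProb x y w ≤ 1 := by
  rw [outputProb, outputProb, ← measure_union _ (P.measurableSet_result x y w)]
  · exact prob_le_one
  · rw [Set.disjoint_left]
    intro ω hv hw
    exact h (hv.symm.trans hw)

/-- The probability that the parties answer as in the (reversed) view `B`. -/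
noncomputable def viewProb (P : Protocol X Y σ m n) (ρ : P.RefCoins) (x : Fin m → X)
    (y : Fin n → X) (B : P.View) : ℝ≥0∞ :=
  P.curator.law (P.curator.consistent x (P.curatorLog ρ B)) *
    ∏ i, (P.agent i).law ((P.agent i).consistent (fun _ => y i) (P.agentLog ρ i B))

-- There are countably many views, so the probability of any property of the view is a sum of the
-- products `viewProb`. The lower bounds involving agents compare such sums term by term.
open Classical in
theorem partyLaw_revRun (P : Protocol X Y σ m n) (ρ : P.RefCoins) (x : Fin m → X)
    (y : Fin n → X) (τ : List Round) (p : P.View → Prop) :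
    P.partyLaw {ω | p (P.revRun x y (ρ, ω) τ)} =
      ∑' B : P.View, if P.shape B = τ ∧ p B then P.viewProb ρ x y B else 0 := by
  have hset : {ω | p (P.revRun x y (ρ, ω) τ)} = ⋃ B : P.View,
      {ω | P.revRun x y (ρ, ω) τ = B ∧ p B} := by
    ext ω; simp
  rw [hset, measure_iUnion]
  · refine tsum_congr fun B => ?_
    split_ifs with h
    · obtain ⟨rfl, hp⟩ := h
      have : {ω | P.revRun x y (ρ, ω) (P.shape B) = B ∧ p B} =
          P.curator.consistent x (P.curatorLog ρ B) ×ˢ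
            Set.univ.pi fun i => (P.agent i).consistent (fun _ => y i) (P.agentLog ρ i B) := by
        ext ω
        simp [revRun_eq_iff, hp]
      rw [this, Measure.prod_prod, Measure.pi_pi, viewProb]
    · convert measure_empty (μ := P.partyLaw)
      ext ω
      simp only [Set.mem_ofPred_eq, Set.mem_empty_iff_false, iff_false]
      rintro ⟨rfl, hp⟩
      exact h ⟨P.shape_revRun x y _ τ, hp⟩
  · intro B B' hB
    rw [Function.onFun, Set.disjoint_left]
    rintro ω ⟨h1, -⟩ ⟨h2, -⟩
    exact hB (h1.symm.trans h2)
  · intro B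
    have h1 : MeasurableSet {ω | P.revRun x y (ρ, ω) τ = B} :=
      measurable_prodMk_left (P.measurableSet_revRun_eq x y τ B)
    exact h1.inter (MeasurableSet.const _)

open Classical in
theorem tsum_viewProb (P : Protocol X Y σ m n) (ρ : P.RefCoins) (x : Fin m → X)
    (y : Fin n → X) (τ : List Round) :
    ∑' B : P.View, (if P.shape B = τ then P.viewProb ρ x y B else 0) = 1 := by
  have := P.partyLaw_revRun ρ x y τ fun _ => True
  simpa using this.symm

end Protocol

/-! ### Samples generated from seeds that do not depend on the strings and the shares -/

section Sampling

variable {c d k : ℕ}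

theorem sum_map_uniformOfFintype_mul {α β : Type*} [Fintype α] [Nonempty α] [Fintype β]
    (f : α → β) (F : β → ℝ≥0∞) :
    ∑ z, ((PMF.uniformOfFintype α).map f) z * F z =
      (Fintype.card α : ℝ≥0∞)⁻¹ * ∑ a, F (f a) := by
  classical
  simp only [PMF.map_apply, tsum_fintype, PMF.uniformOfFintype_apply, Finset.sum_mul, ite_mul,
    zero_mul]
  rw [Finset.sum_comm, Finset.mul_sum]
  refine Finset.sum_congr rfl fun a _ => ?_
  simp

theorem sum_sampleLaw_mul (r : Bits d → Bits c) (s : Fin (k + 1) → Bits d)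
    (F : Point c d (k + 1) → ℝ≥0∞) :
    ∑ z, sampleLaw r s z * F z =
      2⁻¹ * ((2 ^ c : ℝ≥0∞)⁻¹ * ∑ x, F (.inl (x, fun j => x ⬝ᵥ r j))) +
      2⁻¹ * ((k + 1 : ℝ≥0∞)⁻¹ * ∑ t, F (.inr (t, s t))) := by
  have h1 := sum_map_uniformOfFintype_mul
    (fun x : Bits c => (Sum.inl (x, fun j => x ⬝ᵥ r j) : Point c d (k + 1))) F
  have h2 := sum_map_uniformOfFintype_mul
    (fun t : Fin (k + 1) => (Sum.inr (t, s t) : Point c d (k + 1))) F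
  simp only [Fintype.card_pi, ZMod.card, Finset.prod_const, Finset.card_univ,
    Fintype.card_fin, Nat.cast_pow, Nat.cast_ofNat, Nat.cast_add, Nat.cast_one] at h1 h2
  rw [← h1, ← h2, Finset.mul_sum, Finset.mul_sum, ← Finset.sum_add_distrib]
  refine Finset.sum_congr rfl fun z _ => ?_
  rw [sampleLaw, PMF.bind_apply, tsum_fintype, Fintype.sum_bool]
  simp [add_mul, mul_assoc]

/-- The coins from which a sample is generated, independently of the strings and the shares. -/
abbrev Seed (c k : ℕ) : Type := Bool × Bits c × Fin (k + 1)

/-- The sample generated from a seed. -/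
def Seed.point (r : Bits d → Bits c) (s : Fin (k + 1) → Bits d) (u : Seed c k) :
    Point c d (k + 1) :=
  if u.1 then .inl (u.2.1, fun j => u.2.1 ⬝ᵥ r j) else .inr (u.2.2, s u.2.2)

/-- A seed draws both a vector and a share index although the point uses only one; the idle
coordinate sums to a factor one. Seeds are thus uniform on a fixed set, and strings and shares can
be averaged with the seeds held fixed. -/
theorem sampleLaw_apply (r : Bits d → Bits c) (s : Fin (k + 1) → Bits d)
    (z : Point c d (k + 1)) :
    sampleLaw r s z =
      ∑ u : Seed c k, if u.point r s = z then (Fintype.card (Seed c k) : ℝ≥0∞)⁻¹ else 0 := by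
  classical
  have h := sum_sampleLaw_mul r s (fun z' => if z' = z then 1 else 0)
  simp only [mul_ite, mul_one, mul_zero, Finset.sum_ite_eq', Finset.mem_univ, if_true] at h
  have hc : (Fintype.card (Seed c k) : ℝ≥0∞)⁻¹ =
      2⁻¹ * ((2 ^ c : ℝ≥0∞)⁻¹ * (k + 1 : ℝ≥0∞)⁻¹) := by
    have : (Fintype.card (Seed c k) : ℝ≥0∞) = 2 * (2 ^ c * (k + 1)) := by
      simp
    rw [this, ENNReal.mul_inv (by simp) (by simp), ENNReal.mul_inv (by simp) (by simp)]
  have hk : (k + 1 : ℝ≥0∞)⁻¹ * (k + 1 : ℝ≥0∞) = 1 :=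
    ENNReal.inv_mul_cancel (by simp) (by finiteness)
  have hc2 : (2 ^ c : ℝ≥0∞)⁻¹ * (2 ^ c : ℝ≥0∞) = 1 :=
    ENNReal.inv_mul_cancel (by simp) (by finiteness)
  have e1 : (2 ^ c : ℝ≥0∞)⁻¹ * ∑ x : Bits c,
        (if (Sum.inl (x, fun j => x ⬝ᵥ r j) : Point c d (k + 1)) = z then (1 : ℝ≥0∞) else 0) =
      ∑ x : Bits c, ∑ _t : Fin (k + 1),
        if (Sum.inl (x, fun j => x ⬝ᵥ r j) : Point c d (k + 1)) = z then
          (2 ^ c : ℝ≥0∞)⁻¹ * (k + 1 : ℝ≥0∞)⁻¹ else 0 := by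
    rw [Finset.mul_sum]
    refine Finset.sum_congr rfl fun x _ => ?_
    rw [Finset.sum_const, Finset.card_univ, Fintype.card_fin, nsmul_eq_mul]
    split_ifs
    · rw [mul_left_comm, mul_one]; push_cast; rw [mul_comm (k + 1 : ℝ≥0∞), hk, mul_one]
    · simp
  have e2 : (k + 1 : ℝ≥0∞)⁻¹ * ∑ t : Fin (k + 1),
        (if (Sum.inr (t, s t) : Point c d (k + 1)) = z then (1 : ℝ≥0∞) else 0) =
      ∑ _x : Bits c, ∑ t : Fin (k + 1),
        if (Sum.inr (t, s t) : Point c d (k + 1)) = z then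
          (2 ^ c : ℝ≥0∞)⁻¹ * (k + 1 : ℝ≥0∞)⁻¹ else 0 := by
    rw [Finset.sum_comm, Finset.mul_sum]
    refine Finset.sum_congr rfl fun x _ => ?_
    rw [Finset.sum_const, Finset.card_univ, nsmul_eq_mul]
    have : (Fintype.card (Bits c) : ℝ≥0∞) = 2 ^ c := by simp
    rw [this]
    split_ifs
    · rw [← mul_assoc, mul_comm (2 ^ c : ℝ≥0∞), hc2, one_mul, mul_one]
    · simp
  rw [h, e1, e2, Fintype.sum_prod_type, Fintype.sum_bool, Fintype.sum_prod_type,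
    Fintype.sum_prod_type, hc]
  simp [Seed.point, Finset.mul_sum, mul_left_comm (2⁻¹ : ℝ≥0∞)]

theorem sum_prod_sampleLaw_mul {ℓ : ℕ} (r : Bits d → Bits c) (s : Fin (k + 1) → Bits d)
    (F : (Fin ℓ → Point c d (k + 1)) → ℝ≥0∞) :
    ∑ x : Fin ℓ → Point c d (k + 1), (∏ i, sampleLaw r s (x i)) * F x =
      (Fintype.card (Fin ℓ → Seed c k) : ℝ≥0∞)⁻¹ *
        ∑ u : Fin ℓ → Seed c k, F fun i => (u i).point r s := by
  classical
  have h : ∀ x : Fin ℓ → Point c d (k + 1), ∏ i, sampleLaw r s (x i) =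
      ∑ u : Fin ℓ → Seed c k, if (fun i => (u i).point r s) = x then
        (Fintype.card (Fin ℓ → Seed c k) : ℝ≥0∞)⁻¹ else 0 := by
    intro x
    simp only [sampleLaw_apply]
    rw [Finset.prod_univ_sum, Fintype.piFinset_univ]
    refine Finset.sum_congr rfl fun u _ => ?_
    split_ifs with hu
    · subst hu
      simp only [if_true, Finset.prod_const, Finset.card_univ, Fintype.card_fin]
      rw [Fintype.card_fun, Nat.cast_pow, Fintype.card_fin, ENNReal.inv_pow]
    · obtain ⟨i, hi⟩ := Function.ne_iff.1 hu
      exact Finset.prod_eq_zero (Finset.mem_univ i) (if_neg hi)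
  simp only [h, Finset.sum_mul, ite_mul, zero_mul]
  rw [Finset.sum_comm, Finset.mul_sum]
  refine Finset.sum_congr rfl fun u _ => ?_
  simp

/-- If for all seeds the average success probability over a finite family of parameters is at
most `b`, then a protocol that solves the task has `1 - β ≤ b`. -/
theorem SolvesOneOutOfParity.le_of_seeds {m n : ℕ} {σ : List Round}
    {P : Protocol (Point c d (k + 1)) (Bits c) σ m n} {β : ℝ} (hP : SolvesOneOutOfParity P β)
    {Θ : Type} [Fintype Θ] [Nonempty Θ] (r : Θ → Bits d → Bits c)
    (s : Θ → Fin (k + 1) → Bits d) {b : ℝ≥0∞}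
    (h : ∀ (u : Fin m → Seed c k) (w : Fin n → Seed c k),
      ∑ θ, P.outputProb (fun i => (u i).point (r θ) (s θ)) (fun i => (w i).point (r θ) (s θ))
        (r θ (∑ t, s θ t)) ≤ Fintype.card Θ * b) :
    ENNReal.ofReal (1 - β) ≤ b := by
  have h1 : ∀ θ, ENNReal.ofReal (1 - β) ≤ (Fintype.card (Fin m → Seed c k) : ℝ≥0∞)⁻¹ *
      ∑ u : Fin m → Seed c k, (Fintype.card (Fin n → Seed c k) : ℝ≥0∞)⁻¹ *
        ∑ w : Fin n → Seed c k, P.outputProb (fun i => (u i).point (r θ) (s θ))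
          (fun i => (w i).point (r θ) (s θ)) (r θ (∑ t, s θ t)) := by
    intro θ
    refine (hP (r θ) (s θ)).trans (le_of_eq ?_)
    simp only [mul_assoc, ← Finset.mul_sum]
    rw [sum_prod_sampleLaw_mul (r θ) (s θ) fun x => ∑ y : Fin n → Point c d (k + 1),
      (∏ i, sampleLaw (r θ) (s θ) (y i)) * P.outputProb x y (r θ (∑ t, s θ t))]
    simp only [sum_prod_sampleLaw_mul]
    simp only [← Finset.mul_sum]
  have h2 : (Fintype.card Θ : ℝ≥0∞) * ENNReal.ofReal (1 - β) ≤ Fintype.card Θ * b := by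
    calc (Fintype.card Θ : ℝ≥0∞) * ENNReal.ofReal (1 - β)
        = ∑ _θ : Θ, ENNReal.ofReal (1 - β) := by simp
      _ ≤ _ := Finset.sum_le_sum fun θ _ => h1 θ
      _ = (Fintype.card (Fin m → Seed c k) : ℝ≥0∞)⁻¹ *
          ∑ u : Fin m → Seed c k, (Fintype.card (Fin n → Seed c k) : ℝ≥0∞)⁻¹ *
            ∑ w : Fin n → Seed c k, ∑ θ, P.outputProb (fun i => (u i).point (r θ) (s θ))
              (fun i => (w i).point (r θ) (s θ)) (r θ (∑ t, s θ t)) := by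
        rw [← Finset.mul_sum, Finset.sum_comm]
        congr 1
        refine Finset.sum_congr rfl fun u _ => ?_
        rw [← Finset.mul_sum, Finset.sum_comm]
      _ ≤ (Fintype.card (Fin m → Seed c k) : ℝ≥0∞)⁻¹ *
          ∑ u : Fin m → Seed c k, (Fintype.card (Fin n → Seed c k) : ℝ≥0∞)⁻¹ *
            ∑ w : Fin n → Seed c k, Fintype.card Θ * b := by
        gcongr with u _ w _
        exact h u w
      _ = Fintype.card Θ * b := by
        simp only [Finset.sum_const, Finset.card_univ, nsmul_eq_mul, ← mul_assoc]
        rw [ENNReal.inv_mul_cancel (by simp) (ENNReal.natCast_ne_top _), one_mul,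
          ENNReal.inv_mul_cancel (by simp) (ENNReal.natCast_ne_top _), one_mul]
  exact (ENNReal.mul_le_mul_iff_right (by simp) (by simp)).1 h2

/-- With fewer samples than shares, some share is not among the samples. -/
theorem exists_missing_share {ℓ : ℕ} (hℓ : ℓ < k + 1) (u : Fin ℓ → Seed c k) :
    ∃ t, ∀ i, (u i).2.2 ≠ t := by
  by_contra! h
  choose f hf using h
  have : Function.Injective f := fun t t' e => by rw [← hf t, ← hf t', e]
  have := Fintype.card_le_of_injective f this
  simp only [Fintype.card_fin] at this
  omega

theorem Seed.point_add_single {u : Seed c k} {t : Fin (k + 1)} (h : u.2.2 ≠ t)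
    (r : Bits d → Bits c) (s : Fin (k + 1) → Bits d) (v : Bits d) :
    u.point r (s + (Pi.single t v : Fin (k + 1) → Bits d)) = u.point r s := by
  simp [Seed.point, h]

/-- To average over all shares, average over one share and use that its value is uniform. -/
theorem sum_shares_le {t : Fin (k + 1)} {F : (Fin (k + 1) → Bits d) → ℝ≥0∞} {b : ℝ≥0∞}
    (h : ∀ s, ∑ v, F (s + (Pi.single t v : Fin (k + 1) → Bits d)) ≤ Fintype.card (Bits d) * b) :
    ∑ s, F s ≤ Fintype.card (Fin (k + 1) → Bits d) * b := by
  have h1 : (Fintype.card (Bits d) : ℝ≥0∞) * ∑ s, F s ≤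
      Fintype.card (Bits d) * (Fintype.card (Fin (k + 1) → Bits d) * b) := by
    calc (Fintype.card (Bits d) : ℝ≥0∞) * ∑ s, F s
        = ∑ v : Bits d, ∑ s, F (s + (Pi.single t v : Fin (k + 1) → Bits d)) := by
          have : ∀ v : Bits d,
              ∑ s, F (s + (Pi.single t v : Fin (k + 1) → Bits d)) = ∑ s, F s := fun v =>
            Fintype.sum_equiv (Equiv.addRight (Pi.single t v : Fin (k + 1) → Bits d)) _ _
              fun _ => rfl
          simp [this]
      _ = ∑ s, ∑ v : Bits d, F (s + (Pi.single t v : Fin (k + 1) → Bits d)) := Finset.sum_comm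
      _ ≤ ∑ _s : Fin (k + 1) → Bits d, Fintype.card (Bits d) * b :=
          Finset.sum_le_sum fun s _ => h s
      _ = _ := by
          rw [Finset.sum_const, Finset.card_univ, nsmul_eq_mul]; ring
  exact (ENNReal.mul_le_mul_iff_right (by simp) (by simp)).1 h1

theorem sum_add_single (s : Fin (k + 1) → Bits d) (t : Fin (k + 1)) (v : Bits d) :
    ∑ t', (s + (Pi.single t v : Fin (k + 1) → Bits d)) t' = ∑ t', s t' + v := by
  simp [Finset.sum_add_distrib]

end Sampling

/-! ### Impossibility for the curator alone -/

/-- Without agents, fewer samples than shares do not suffice, private or not. -/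
theorem not_solves_of_curator_only {c d m : ℕ} {σ : List Round} (hc : 1 ≤ c) (hd : 1 ≤ d)
    (P : Protocol (Point c d (m + 1)) (Bits c) σ m 0) : ¬ SolvesOneOutOfParity P (1 / 4) := by
  intro hP
  let j₀ : Fin d := ⟨0, hd⟩
  -- All bits of `r j` equal the first bit of `j`, so flipping that bit changes the string to be
  -- output.
  let r : Bits d → Bits c := fun j _ => j j₀
  have key : ENNReal.ofReal (1 - 1 / 4) ≤ 2⁻¹ := by
    refine hP.le_of_seeds (Θ := Fin (m + 1) → Bits d) (fun _ => r) (fun s => s) fun u w => ?_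
    obtain ⟨t, ht⟩ := exists_missing_share (Nat.lt_succ_self m) u
    refine sum_shares_le (t := t) fun s => ?_
    simp only [sum_add_single, Seed.point_add_single (ht _)]
    have hw : ∀ v : Bits d,
        (fun i => (w i).point r (s + (Pi.single t v : Fin (m + 1) → Bits d))) = Fin.elim0 :=
      fun v => Subsingleton.elim _ _
    simp only [hw]
    set f : Bits d → ℝ≥0∞ := fun j => P.outputProb (fun i => (u i).point r s) Fin.elim0 (r j)
    have e1 : ∑ v, f (∑ t', s t' + v) = ∑ j, f j :=
      Fintype.sum_equiv (Equiv.addLeft _) _ _ fun _ => rfl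
    -- Pairing `j` with its flip, the curator's data are the same but the correct outputs differ;
    -- the two success probabilities add up to at most one.
    have e2 : ∑ j, f (j + Pi.single j₀ 1) = ∑ j, f j :=
      Fintype.sum_equiv (Equiv.addRight (Pi.single j₀ 1 : Bits d)) _ _ fun _ => rfl
    have e3 : ∑ j, f j + ∑ j, f j ≤ Fintype.card (Bits d) := by
      calc ∑ j, f j + ∑ j, f j = ∑ j, (f j + f (j + Pi.single j₀ 1)) := by
            rw [Finset.sum_add_distrib, e2]
        _ ≤ ∑ _j : Bits d, 1 := by
            refine Finset.sum_le_sum fun j _ => P.outputProb_add_le _ _ fun h => ?_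
            have := congrFun h ⟨0, hc⟩
            simp [r] at this
        _ = _ := by simp
    change ∑ v, f (∑ t', s t' + v) ≤ _
    rw [e1, ← div_eq_mul_inv, ENNReal.le_div_iff_mul_le (by simp) (by simp), mul_two]
    exact e3
  have h2 : (2⁻¹ : ℝ≥0∞) = ENNReal.ofReal (1 / 2) := by
    rw [one_div, ENNReal.ofReal_inv_of_pos (by norm_num)]; simp
  rw [h2, ENNReal.ofReal_le_ofReal_iff (by norm_num)] at key
  norm_num at key

/-! ### Guessing many strings from one nearly uninformative observation -/

section Counting

variable {J V : Type*} [Fintype J] [Fintype V] [DecidableEq J] [DecidableEq V]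

/-- Few functions agree with a given one in more than five eighths of the places. -/
theorem card_agree_le (hV : 2 ≤ Fintype.card V) {Q : ℕ} (hJ : Fintype.card J = 8 * Q)
    (o : J → V) :
    (Finset.card {r : J → V | 5 * Q < Finset.card {j | o j = r j}} : ℝ) ≤
      (4 / 5) ^ Q * Fintype.card (J → V) := by
  have hV' : (2 : ℝ) ≤ Fintype.card V := by exact_mod_cast hV
  -- Exponential Markov inequality with base `3 / 2`. The mean per place is `1 + 1 / (2 * card V) ≤
  -- 5 / 4`, and `(5 / 4) ^ 8 ≤ (3 / 2) ^ 5 * (4 / 5)`.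
  have h1 : ∑ r : J → V, (3 / 2 : ℝ) ^ Finset.card {j | o j = r j} =
      (Fintype.card V + 1 / 2) ^ (8 * Q) := by
    have h : ∀ r : J → V, (3 / 2 : ℝ) ^ Finset.card {j | o j = r j} =
        ∏ j, if o j = r j then (3 / 2 : ℝ) else 1 := by
      intro r
      rw [Finset.prod_ite, Finset.prod_const, Finset.prod_const_one, mul_one]
    simp only [h]
    rw [← Fintype.piFinset_univ, ← Finset.prod_univ_sum (fun _ => Finset.univ)
      fun j v => if o j = v then (3 / 2 : ℝ) else 1]
    have h' : ∀ j, ∑ v, (if o j = v then (3 / 2 : ℝ) else 1) = Fintype.card V + 1 / 2 := by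
      intro j
      have : ∀ v, (if o j = v then (3 / 2 : ℝ) else 1) = 1 + if o j = v then 1 / 2 else 0 := by
        intro v; split_ifs <;> norm_num
      simp [this, Finset.sum_add_distrib]
    simp only [h', Finset.prod_const, Finset.card_univ, hJ]
  have h2 : (Finset.card {r : J → V | 5 * Q < Finset.card {j | o j = r j}} : ℝ) *
      (3 / 2) ^ (5 * Q) ≤ (Fintype.card V + 1 / 2) ^ (8 * Q) := by
    rw [← h1, ← nsmul_eq_mul, ← Finset.sum_const]
    refine (Finset.sum_le_sum fun r hr => ?_).trans
      (Finset.sum_le_sum_of_subset_of_nonneg (Finset.subset_univ _) fun r _ _ => by positivity)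
    exact pow_le_pow_right₀ (by norm_num) (Finset.mem_filter.1 hr).2.le
  have h3 : ((Fintype.card V : ℝ) + 1 / 2) ^ (8 * Q) ≤
      (3 / 2) ^ (5 * Q) * ((4 / 5) ^ Q * Fintype.card (J → V)) := by
    calc ((Fintype.card V : ℝ) + 1 / 2) ^ (8 * Q) ≤ (5 / 4 * Fintype.card V) ^ (8 * Q) := by
          gcongr; linarith
      _ = ((5 / 4) ^ 8) ^ Q * Fintype.card (J → V) := by
          rw [mul_pow, Fintype.card_fun, hJ, ← pow_mul]; push_cast; ring
      _ ≤ ((3 / 2) ^ 5 * (4 / 5)) ^ Q * Fintype.card (J → V) := by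
          gcongr; norm_num
      _ = _ := by rw [mul_pow, ← pow_mul]; ring
  have h4 : (0 : ℝ) < (3 / 2) ^ (5 * Q) := by positivity
  exact le_of_mul_le_mul_left (by linarith [h2.trans h3]) h4

/-- If the laws `w r` of an observation are all dominated by `K` times one of them, then nobody
who sees the observation can guess `r j` for an average `j`, unless `K` is huge. -/
theorem sum_agree_le {β : Type*} (hV : 2 ≤ Fintype.card V) {Q : ℕ}
    (hJ : Fintype.card J = 8 * Q) (o : β → J → V) (w : (J → V) → β → ℝ≥0∞) (r₀ : J → V)
    (K : ℝ≥0∞) (hw : ∀ r B, w r B ≤ K * w r₀ B) (h1 : ∀ r, ∑' B, w r B ≤ 1) :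
    ∑ r, ∑ j, ∑' B, (if o B j = r j then w r B else 0) ≤
      Fintype.card (J → V) *
        (Fintype.card J * (ENNReal.ofReal (5 / 8) + K * ENNReal.ofReal ((4 / 5) ^ Q))) := by
  set N : β → (J → V) → ℕ := fun B r => Finset.card {j | o B j = r j}
  have hN : ∀ B r, N B r ≤ 8 * Q := fun B r => hJ ▸ Finset.card_le_univ _
  have hcard : ∀ B, (Finset.card {r : J → V | 5 * Q < N B r} : ℝ≥0∞) ≤
      ENNReal.ofReal ((4 / 5) ^ Q) * Fintype.card (J → V) := by
    intro B
    have := ENNReal.ofReal_le_ofReal (card_agree_le hV hJ (o B))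
    rwa [ENNReal.ofReal_natCast, ENNReal.ofReal_mul (by positivity), ENNReal.ofReal_natCast] at this
  -- Tables `r` with at most `5 * Q` agreements contribute at most that count; the rare others are
  -- charged all `8 * Q` places, with `w r B` replaced by `K * w r₀ B`.
  have hB : ∀ B, ∑ r, ∑ j, (if o B j = r j then w r B else 0) ≤
      (5 * Q : ℕ) * ∑ r, w r B + (8 * Q : ℕ) * (K * w r₀ B *
        (ENNReal.ofReal ((4 / 5) ^ Q) * Fintype.card (J → V))) := by
    intro B
    calc ∑ r, ∑ j, (if o B j = r j then w r B else 0) = ∑ r, (N B r : ℝ≥0∞) * w r B := by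
          refine Finset.sum_congr rfl fun r _ => ?_
          rw [Finset.sum_ite, Finset.sum_const, Finset.sum_const_zero, add_zero, nsmul_eq_mul]
      _ ≤ ∑ r, ((5 * Q : ℕ) * w r B +
            if 5 * Q < N B r then (8 * Q : ℕ) * (K * w r₀ B) else 0) := by
          refine Finset.sum_le_sum fun r _ => ?_
          split_ifs with h
          · refine le_add_left ?_
            have := hN B r
            gcongr
            exact hw r B
          · rw [add_zero]
            have := not_lt.1 h
            gcongr
      _ = (5 * Q : ℕ) * ∑ r, w r B + (8 * Q : ℕ) * (K * w r₀ B *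
            Finset.card {r : J → V | 5 * Q < N B r}) := by
          rw [Finset.sum_add_distrib, ← Finset.mul_sum, ← Finset.sum_filter, Finset.sum_const,
            nsmul_eq_mul]
          ring
      _ ≤ _ := by gcongr; exact hcard B
  calc ∑ r, ∑ j, ∑' B, (if o B j = r j then w r B else 0)
      = ∑' B, ∑ r, ∑ j, (if o B j = r j then w r B else 0) := by
        rw [Summable.tsum_finsetSum fun _ _ => ENNReal.summable]
        refine Finset.sum_congr rfl fun r _ => ?_
        rw [Summable.tsum_finsetSum fun _ _ => ENNReal.summable]
    _ ≤ ∑' B, ((5 * Q : ℕ) * ∑ r, w r B + (8 * Q : ℕ) * (K * w r₀ B *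
        (ENNReal.ofReal ((4 / 5) ^ Q) * Fintype.card (J → V)))) := ENNReal.tsum_le_tsum hB
    _ = (5 * Q : ℕ) * ∑ r, ∑' B, w r B + (8 * Q : ℕ) * (K * (∑' B, w r₀ B) *
        (ENNReal.ofReal ((4 / 5) ^ Q) * Fintype.card (J → V))) := by
        rw [ENNReal.tsum_add, ENNReal.tsum_mul_left, ENNReal.tsum_mul_left, ENNReal.tsum_mul_right,
          ENNReal.tsum_mul_left, Summable.tsum_finsetSum fun _ _ => ENNReal.summable]
    _ ≤ (5 * Q : ℕ) * ∑ _r : J → V, 1 + (8 * Q : ℕ) * (K * 1 *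
        (ENNReal.ofReal ((4 / 5) ^ Q) * Fintype.card (J → V))) := by
        gcongr with r _
        · exact h1 r
        · exact h1 r₀
    _ = _ := by
        have h58 : ((5 * Q : ℕ) : ℝ≥0∞) = (8 * Q : ℕ) * ENNReal.ofReal (5 / 8) := by
          rw [← ENNReal.ofReal_natCast, ← ENNReal.ofReal_natCast (8 * Q),
            ← ENNReal.ofReal_mul (by positivity)]
          congr 1; push_cast; ring
        rw [h58, hJ, Finset.sum_const, Finset.card_univ, nsmul_eq_mul]
        ring

end Counting

/-- Superadditivity of the lower integral is used because it needs no measurability of the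
integrands. -/
theorem sum_lintegral_le {α ι : Type*} [MeasurableSpace α] (μ : Measure α) (s : Finset ι)
    (f : ι → α → ℝ≥0∞) : ∑ i ∈ s, ∫⁻ a, f i a ∂μ ≤ ∫⁻ a, ∑ i ∈ s, f i a ∂μ := by
  classical
  induction s using Finset.induction_on with
  | empty => simp
  | insert i s hi ih =>
    simp only [Finset.sum_insert hi]
    exact (add_le_add le_rfl ih).trans (le_lintegral_add _ _)

/-- Taking some coordinates from one sample and the others from an independent one. -/
theorem measurePreserving_combine {ι : Type*} [Fintype ι] {α : ι → Type*}
    [∀ i, MeasurableSpace (α i)] (μ : ∀ i, Measure (α i)) [∀ i, IsProbabilityMeasure (μ i)]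
    (S : ι → Prop) [DecidablePred S] :
    MeasurePreserving (fun (p : (∀ i, α i) × ∀ i, α i) i => if S i then p.1 i else p.2 i)
      ((Measure.pi μ).prod (Measure.pi μ)) (Measure.pi μ) := by
  have hm : Measurable (fun (p : (∀ i, α i) × ∀ i, α i) i => if S i then p.1 i else p.2 i) := by
    refine measurable_pi_lambda _ fun i => ?_
    split_ifs <;> fun_prop
  refine ⟨hm, (Measure.pi_eq fun s hs => ?_).symm⟩
  rw [Measure.map_apply hm (MeasurableSet.univ_pi hs)]
  have : (fun (p : (∀ i, α i) × ∀ i, α i) i => if S i then p.1 i else p.2 i) ⁻¹'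
      Set.univ.pi s = (Set.univ.pi fun i => if S i then s i else Set.univ) ×ˢ
        (Set.univ.pi fun i => if S i then Set.univ else s i) := by
    ext p
    simp only [Set.mem_preimage, Set.mem_pi, Set.mem_univ, true_imp_iff, Set.mem_prod,
      ← forall_and]
    refine forall_congr' fun i => ?_
    split_ifs <;> simp
  rw [this, Measure.prod_prod, Measure.pi_pi, Measure.pi_pi, ← Finset.prod_mul_distrib]
  refine Finset.prod_congr rfl fun i _ => ?_
  split_ifs <;> simp

/-! ### Simulating the agents that hold shares -/

namespace Protocol

variable {X Y : Type} {σ : List Round} {m n : ℕ}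

/-- This is where the order of the schedule enters: as long as only the curator is asked, the view,
and with it the next queries, cannot depend on the agents. -/
theorem revRun_replicate_curator (P : Protocol X Y σ m n) (x : Fin m → X) (y y' : Fin n → X)
    (ρ : P.RefCoins) (ω : P.curator.Coins) (η η' : ∀ i, (P.agent i).Coins) (k : ℕ) :
    P.revRun x y (ρ, ω, η) (List.replicate k .curator) =
      P.revRun x y' (ρ, ω, η') (List.replicate k .curator) := by
  induction k with
  | zero => rfl
  | succ k ih => simp only [List.replicate_succ, revRun, ih]

/-- Replace the last answers of the agents outside `S` by those for the inputs `y` and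
the coins `η`. -/
def overrideLast (P : Protocol X Y σ m n) (ρ : P.RefCoins) (S : Fin n → Prop) [DecidablePred S]
    (y : Fin n → X) (η : ∀ i, (P.agent i).Coins) : P.View → P.View
  | .inr b :: B => .inr (fun i => if S i then b i else (P.agent i).reply (fun _ => y i) (η i)
      (P.toAgent ρ B.reverse i :: (P.agentLog ρ i B).map Prod.fst).reverse) :: B
  | B => B

/-- The queries to the agents are determined by the curator's answers, which `z` and the mixed input
share; hence the answers outside `S` can be recomputed from the view and put in afterwards. -/
theorem revRun_combine (P : Protocol X Y σ m n) (x : Fin m → X) (y z : Fin n → X)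
    (ρ : P.RefCoins) (ω : P.curator.Coins) (ξ η : ∀ i, (P.agent i).Coins)
    (S : Fin n → Prop) [DecidablePred S] (k : ℕ) :
    P.revRun x (fun i => if S i then z i else y i) (ρ, ω, fun i => if S i then ξ i else η i)
        (.agents :: List.replicate k .curator) =
      P.overrideLast ρ S y η
        (P.revRun x z (ρ, ω, ξ) (.agents :: List.replicate k .curator)) := by
  simp only [revRun, overrideLast]
  rw [P.revRun_replicate_curator x (fun i => if S i then z i else y i) z ρ ω
    (fun i => if S i then ξ i else η i) ξ k]
  congr 2
  funext i
  split_ifs <;> rfl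

-- Separates the two kinds of agents: for fixed fresh coins `η` outside `S`, the result is a
-- function of a view whose law involves only `x` and `z`, while `y` enters through the override
-- alone.
open Classical in
theorem partyLaw_result_combine [DecidableEq Y] {k : ℕ}
    (P : Protocol X Y (List.replicate k .curator ++ [.agents]) m n) (x : Fin m → X)
    (y z : Fin n → X) (ρ : P.RefCoins) (S : Fin n → Prop) [DecidablePred S] (v : Y) :
    P.partyLaw {ω | P.result x (fun i => if S i then z i else y i) (ρ, ω) = v} =
      ∫⁻ η, ∑' B : P.View, (if P.output ρ (P.overrideLast ρ S y η B).reverse = v then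
        if P.shape B = .agents :: List.replicate k .curator then P.viewProb ρ x z B else 0
        else 0) ∂Measure.pi fun i => (P.agent i).law := by
  have hσ : (List.replicate k Round.curator ++ [Round.agents]).reverse =
      .agents :: List.replicate k .curator := by simp
  set E := {ω | P.result x (fun i => if S i then z i else y i) (ρ, ω) = v} with hEdef
  have hE : MeasurableSet E := measurable_prodMk_left (P.measurableSet_result x _ v)
  -- The coins of the agents outside `S` are taken from an independent second copy.
  have hmp := ((MeasurePreserving.id P.curator.law).prod
    (measurePreserving_combine (fun i => (P.agent i).law) S)).comp
    (measurePreserving_prodAssoc P.curator.law (Measure.pi fun i => (P.agent i).law)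
      (Measure.pi fun i => (P.agent i).law))
  rw [← hmp.measure_preimage hE.nullMeasurableSet, Measure.prod_apply_symm (hmp.measurable hE)]
  refine lintegral_congr fun η => ?_
  have := P.partyLaw_revRun ρ x z (.agents :: List.replicate k .curator) fun B =>
    P.output ρ (P.overrideLast ρ S y η B).reverse = v
  refine Eq.trans ?_ (this.trans (tsum_congr fun B => ?_))
  · congr 1
    ext ω
    have h := P.revRun_combine x y z ρ ω.1 ω.2 η S k
    change P.result x _ (ρ, ω.1, fun i => if S i then ω.2 i else η i) = v ↔ _
    rw [result_eq, hσ, h]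
    rfl
  · split_ifs <;> simp_all

/-- Group privacy costs `m` factors at the curator, and each of the `n` agents costs one. -/
theorem IsPrivate.viewProb_le {P : Protocol X Y σ m n} {ε : ℝ} (hP : P.IsPrivate ε)
    (ρ : P.RefCoins) (x x' : Fin m → X) (y y' : Fin n → X) {B : P.View}
    (hB : P.shape B = σ.reverse) :
    P.viewProb ρ x y B ≤ ENNReal.ofReal (Real.exp ε) ^ (m + n) * P.viewProb ρ x' y' B := by
  have h1 := hP.1.law_consistent_le_pow x x' (L := P.curatorLog ρ B)
    (by rw [length_curatorLog, hB, List.count_reverse])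
  have h2 : ∀ i, (P.agent i).law ((P.agent i).consistent (fun _ => y i) (P.agentLog ρ i B)) ≤
      ENNReal.ofReal (Real.exp ε) *
        (P.agent i).law ((P.agent i).consistent (fun _ => y' i) (P.agentLog ρ i B)) := fun i =>
    (hP.2 i).law_consistent_le (Or.inr ⟨0, fun j hj => (hj (Subsingleton.elim _ _)).elim⟩)
      (by rw [length_agentLog, hB, List.count_reverse])
  calc P.viewProb ρ x y B ≤ _ := mul_le_mul' h1 (Finset.prod_le_prod' fun i _ => h2 i)
    _ = _ := by
      rw [Finset.prod_mul_distrib, Finset.prod_const, Finset.card_univ, Fintype.card_fin, viewProb,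
        pow_add]
      ring

end Protocol

/-- If the curator is asked first and the agents only once afterwards, then the queries to
the agents cannot depend on the hidden string index, and privacy bounds what all answers together
reveal about the `2 ^ d` strings. -/
theorem not_solves_of_curator_first {c d m n k : ℕ} (hc : 1 ≤ c) (hd : 3 ≤ d)
    (hdmn : 16 * (m + n) + 128 ≤ 2 ^ d)
    (P : Protocol (Point c d (m + 1)) (Bits c) (List.replicate k .curator ++ [.agents]) m n)
    (hP : P.IsPrivate (1 / 4)) : ¬ SolvesOneOutOfParity P (1 / 4) := by
  classical
  intro hsol
  -- This makes the number of strings `8 * Q`, so that five eighths of them is an integer.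
  obtain ⟨e, rfl⟩ : ∃ e, d = 3 + e := ⟨d - 3, by omega⟩
  set Q := 2 ^ e
  have hJ : Fintype.card (Bits (3 + e)) = 8 * Q := by
    simp [pow_add, Q]
  have hV : 2 ≤ Fintype.card (Bits c) := by
    simpa using Nat.pow_le_pow_right (n := 2) (by norm_num) hc
  set K := ENNReal.ofReal (Real.exp (1 / 4)) ^ (m + n)
  set b := ENNReal.ofReal (5 / 8) + K * ENNReal.ofReal ((4 / 5) ^ Q)
  have key : ENNReal.ofReal (1 - 1 / 4) ≤ b := by
    refine hsol.le_of_seeds (Θ := (Fin (m + 1) → Bits (3 + e)) × (Bits (3 + e) → Bits c))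
      (fun θ => θ.2) (fun θ => θ.1) fun u w => ?_
    obtain ⟨t, ht⟩ := exists_missing_share (Nat.lt_succ_self m) u
    rw [Fintype.sum_prod_type, Fintype.card_prod, Nat.cast_mul, mul_assoc]
    refine sum_shares_le (t := t) fun s => ?_
    simp only [sum_add_single, Seed.point_add_single (ht _)]
    -- `S` consists of the agents with labelled vectors. Their inputs `z` depend on `r` only, and
    -- the inputs `y` of the others depend only on the shares; the curator's input does not involve
    -- the missing share `t`.
    let S : Fin n → Prop := fun i => (w i).1 = true
    have : DecidablePred S := fun i => inferInstanceAs (Decidable ((w i).1 = true))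
    let z : (Bits (3 + e) → Bits c) → Fin n → Point c (3 + e) (m + 1) :=
      fun r i => .inl ((w i).2.1, fun j => (w i).2.1 ⬝ᵥ r j)
    let y : Bits (3 + e) → Fin n → Point c (3 + e) (m + 1) := fun v i =>
      .inr ((w i).2.2, (s + (Pi.single t v : Fin (m + 1) → Bits (3 + e))) (w i).2.2)
    have hy : ∀ r v, (fun i => (w i).point r
        (s + (Pi.single t v : Fin (m + 1) → Bits (3 + e)))) =
        fun i => if S i then z r i else y v i := by
      intro r v
      funext i
      by_cases h : (w i).1 = true <;> simp [Seed.point, S, z, y, h]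
    simp only [hy, Protocol.outputProb_eq_lintegral]
    set x : (Bits (3 + e) → Bits c) → Fin m → Point c (3 + e) (m + 1) :=
      fun r i => (u i).point r s
    have hswap : ∀ (ρ : P.RefCoins) (η : ∀ i, (P.agent i).Coins),
        ∑ v : Bits (3 + e), ∑ r : Bits (3 + e) → Bits c, ∑' B : P.View,
          (if P.output ρ (P.overrideLast ρ S (y v) η B).reverse = r (∑ t', s t' + v) then
            if P.shape B = .agents :: List.replicate k .curator then
              P.viewProb ρ (x r) (z r) B else 0 else 0) ≤
        Fintype.card (Bits (3 + e)) * (Fintype.card (Bits (3 + e) → Bits c) * b) := by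
      intro ρ η
      -- The guess for the string `j` is the output when the missing share is completed so that the
      -- shares add up to `j`.
      have hbound := sum_agree_le hV hJ
        (fun (B : P.View) j => P.output ρ (P.overrideLast ρ S (y (j - ∑ t', s t')) η B).reverse)
        (fun r B => if P.shape B = .agents :: List.replicate k .curator then
              P.viewProb ρ (x r) (z r) B else 0) 0 K
        (by
          intro r B
          split_ifs with h
          · exact hP.viewProb_le ρ _ _ _ _ (by rw [h]; simp)
          · simp)
        (fun r => (P.tsum_viewProb ρ (x r) (z r) _).le)
      rw [mul_left_comm, Finset.sum_comm]
      refine le_trans (le_of_eq (Finset.sum_congr rfl fun r _ => ?_)) hbound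
      refine Fintype.sum_equiv (Equiv.addLeft (∑ t', s t')) _ _ fun v => ?_
      simp
    calc ∑ v : Bits (3 + e), ∑ r : Bits (3 + e) → Bits c, ∫⁻ ρ,
          P.partyLaw {ω | P.result (x r) (fun i => if S i then z r i else y v i) (ρ, ω) =
            r (∑ t', s t' + v)} ∂P.refLaw
      _ = ∑ v : Bits (3 + e), ∑ r : Bits (3 + e) → Bits c,
          ∫⁻ ρ, ∫⁻ η, ∑' B : P.View,
          (if P.output ρ (P.overrideLast ρ S (y v) η B).reverse = r (∑ t', s t' + v) then
            if P.shape B = .agents :: List.replicate k .curator then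
              P.viewProb ρ (x r) (z r) B else 0 else 0)
            ∂(Measure.pi fun i => (P.agent i).law) ∂P.refLaw := by
          simp only [Protocol.partyLaw_result_combine]
      _ ≤ ∫⁻ ρ, ∫⁻ η, ∑ v : Bits (3 + e), ∑ r : Bits (3 + e) → Bits c, ∑' B : P.View,
          (if P.output ρ (P.overrideLast ρ S (y v) η B).reverse = r (∑ t', s t' + v) then
            if P.shape B = .agents :: List.replicate k .curator then
              P.viewProb ρ (x r) (z r) B else 0 else 0)
            ∂(Measure.pi fun i => (P.agent i).law) ∂P.refLaw := by
          refine (Finset.sum_le_sum fun v _ => sum_lintegral_le _ _ _).trans ?_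
          refine (sum_lintegral_le _ _ _).trans (lintegral_mono fun ρ => ?_)
          refine (Finset.sum_le_sum fun v _ => sum_lintegral_le _ _ _).trans ?_
          exact sum_lintegral_le _ _ _
      _ ≤ ∫⁻ _ρ, ∫⁻ _η, Fintype.card (Bits (3 + e)) *
            (Fintype.card (Bits (3 + e) → Bits c) * b)
            ∂(Measure.pi fun i => (P.agent i).law) ∂P.refLaw :=
          lintegral_mono fun ρ => lintegral_mono fun η => hswap ρ η
      _ = Fintype.card (Bits (3 + e)) * (Fintype.card (Bits (3 + e) → Bits c) * b) := by
          simp only [lintegral_const, measure_univ, mul_one]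
  -- Since `exp (1 / 4) ≤ (5 / 4) ^ 2` and `Q ≥ 2 * (m + n) + 16`, the powers cancel up to `(4 / 5)
  -- ^ 16`; the total `5 / 8 + 1 / 16` stays below `3 / 4`.
  have hK : K * ENNReal.ofReal ((4 / 5) ^ Q) ≤ ENNReal.ofReal (1 / 16) := by
    simp only [K]
    rw [← ENNReal.ofReal_pow (Real.exp_pos _).le, ← ENNReal.ofReal_mul (by positivity)]
    refine ENNReal.ofReal_le_ofReal ?_
    have hexp : Real.exp (1 / 4) ≤ (5 / 4) ^ 2 := by
      have := Real.exp_bound_div_one_sub_of_interval (x := 1 / 4) (by norm_num) (by norm_num)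
      norm_num at this ⊢
      linarith
    have hQ : 2 * (m + n) + 16 ≤ Q := by
      have : 2 ^ (3 + e) = 8 * Q := by rw [pow_add]; rfl
      omega
    obtain ⟨q, hq⟩ := Nat.exists_eq_add_of_le hQ
    calc Real.exp (1 / 4) ^ (m + n) * (4 / 5) ^ Q
        ≤ ((5 / 4) ^ 2) ^ (m + n) * (4 / 5) ^ Q := by gcongr
      _ = ((5 / 4) * (4 / 5)) ^ (2 * (m + n)) * (4 / 5) ^ 16 * (4 / 5) ^ q := by
          rw [hq, ← pow_mul, mul_pow, pow_add _ (2 * (m + n) + 16) q, pow_add _ (2 * (m + n)) 16]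
          simp only [mul_assoc]
      _ ≤ ((5 / 4) * (4 / 5)) ^ (2 * (m + n)) * (4 / 5) ^ 16 * 1 := by
          gcongr; exact pow_le_one₀ (by norm_num) (by norm_num)
      _ ≤ 1 / 16 := by norm_num
  have hfin : ENNReal.ofReal (1 - 1 / 4) ≤ ENNReal.ofReal (5 / 8 + 1 / 16) := by
    rw [ENNReal.ofReal_add (by norm_num) (by norm_num)]
    exact key.trans (add_le_add le_rfl hK)
  rw [ENNReal.ofReal_le_ofReal_iff (by norm_num)] at hfin
  norm_num at hfin

/-! ### Pairwise independent labels and concentration of products -/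

section PairwiseIndependence

variable {c d : ℕ}

/-- Over `ZMod 2` the span of `x'` is `{0, x'}`, so `x` lies outside it and some functional vanishes
on `x'` but not on `x`. -/
theorem exists_dotProduct_eq {x x' : Bits c} (hx : x ≠ 0) (hxx' : x ≠ x') :
    ∃ e : Bits c, x ⬝ᵥ e = 1 ∧ x' ⬝ᵥ e = 0 := by
  have h01 : ∀ a : ZMod 2, a = 0 ∨ a = 1 := by decide
  by_cases h : ∃ i, x i = 1 ∧ x' i = 0
  · obtain ⟨i, h1, h2⟩ := h
    exact ⟨Pi.single i 1, by simp [h1], by simp [h2]⟩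
  -- Here the support of `x` is properly contained in that of `x'`; one unit vector from the support
  -- of `x` and one from the difference cancel on `x'`.
  · push Not at h
    obtain ⟨k, hk⟩ := Function.ne_iff.1 hxx'
    obtain ⟨i, hi⟩ := Function.ne_iff.1 hx
    have hi1 : x i = 1 := (h01 _).resolve_left hi
    have hi2 : x' i = 1 := (h01 _).resolve_left (h i hi1)
    have hk0 : x k = 0 := by
      rcases h01 (x k) with h0 | h1
      · exact h0
      · exact absurd (h1.trans ((h01 _).resolve_left (h k h1)).symm) hk
    have hk1 : x' k = 1 := (h01 _).resolve_left fun h' => hk (hk0.trans h'.symm)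
    refine ⟨Pi.single i 1 + Pi.single k 1, ?_, ?_⟩
    · simp [dotProduct_add, hi1, hk0]
    · rw [dotProduct_add]; simp only [dotProduct_single, hi2, hk1]; decide

/-- For random strings, the labels of distinct points are pairwise independent, so that
a sum over all points is concentrated. -/
theorem sum_sq_dotProduct_le (F : Bits c → (Bits d → ZMod 2) → ℝ) {M : ℝ}
    (h0 : ∀ x b, 0 ≤ F x b) (hM : ∀ x b, F x b ≤ M) :
    ∑ r : Bits d → Bits c, (∑ x, F x (fun j => x ⬝ᵥ r j) -
        (Fintype.card (Bits d → Bits c) : ℝ)⁻¹ *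
          ∑ r' : Bits d → Bits c, ∑ x, F x fun j => x ⬝ᵥ r' j) ^ 2 ≤
      Fintype.card (Bits d → Bits c) * (2 * 2 ^ c * M ^ 2) := by
  classical
  set R := Bits d → Bits c
  set N : ℝ := (Fintype.card R : ℝ)
  have hN : 0 < N := by simp only [N]; exact_mod_cast Fintype.card_pos
  set mean : Bits c → ℝ := fun x => N⁻¹ * ∑ r' : R, F x fun j => x ⬝ᵥ r' j
  set H : Bits c → (Bits d → ZMod 2) → ℝ := fun x b => F x b - mean x
  set h : Bits c → R → ℝ := fun x r => H x fun j => x ⬝ᵥ r j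
  have hsum : ∀ x, ∑ r, h x r = 0 := by
    intro x
    simp only [h, H, Finset.sum_sub_distrib, mean, Finset.sum_const, Finset.card_univ,
      nsmul_eq_mul]
    change _ - N * (N⁻¹ * _) = 0
    rw [mul_inv_cancel_left₀ hN.ne', sub_self]
  have hmean : ∀ x, 0 ≤ mean x ∧ mean x ≤ M := by
    intro x
    refine ⟨mul_nonneg (by positivity) (Finset.sum_nonneg fun r _ => h0 _ _), ?_⟩
    rw [inv_mul_le_iff₀ hN]
    refine (Finset.sum_le_sum fun r _ => hM _ _).trans ?_
    simp [N]
  have habs : ∀ x r, |h x r| ≤ M := by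
    intro x r
    have h1 := hmean x
    have h2 := h0 x fun j => x ⬝ᵥ r j
    have h3 := hM x fun j => x ⬝ᵥ r j
    simp only [h, H]
    rw [abs_le]
    constructor <;> linarith
  -- Adding `b j • e` to every `r j` shifts the labels of `x` by `b` and fixes those of `x'`;
  -- averaging over `b` turns the first factor into its mean, which is zero.
  have horth : ∀ x x', x ≠ 0 → x ≠ x' → ∑ r, h x r * h x' r = 0 := by
    intro x x' hx hxx'
    obtain ⟨e, he, he'⟩ := exists_dotProduct_eq hx hxx'
    let sh : (Bits d → ZMod 2) → R := fun b j => b j • e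
    have e1 : ∀ b, ∑ r, h x (r + sh b) * h x' (r + sh b) = ∑ r, h x r * h x' r := fun b =>
      Fintype.sum_equiv (Equiv.addRight (sh b)) _ _ fun _ => rfl
    have e2 : ∀ b r, h x' (r + sh b) = h x' r := by
      intro b r
      refine congrArg (H x') (funext fun j => ?_)
      change x' ⬝ᵥ (r j + b j • e) = x' ⬝ᵥ r j
      rw [dotProduct_add, dotProduct_smul, he', smul_zero, add_zero]
    have e3 : ∀ r, ∑ b, h x (r + sh b) = ∑ b, H x b := by
      intro r
      refine Fintype.sum_equiv (Equiv.addLeft fun j => x ⬝ᵥ r j) _ _ fun b => ?_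
      refine congrArg (H x) (funext fun j => ?_)
      change x ⬝ᵥ (r j + b j • e) = x ⬝ᵥ r j + b j
      rw [dotProduct_add, dotProduct_smul, he, smul_eq_mul, mul_one]
    have e4 : ∑ b : Bits d → ZMod 2, ∑ r, h x r * h x' r = 0 := by
      rw [← Finset.sum_congr rfl fun b _ => e1 b, Finset.sum_comm]
      simp only [e2, ← Finset.sum_mul, e3]
      rw [← Finset.mul_sum, hsum, mul_zero]
    rw [Finset.sum_const, Finset.card_univ, nsmul_eq_mul] at e4
    exact (mul_eq_zero.1 e4).resolve_left (by exact_mod_cast Fintype.card_pos.ne')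
  have hbound : ∀ x x', ∑ r, h x r * h x' r ≤ N * M ^ 2 := by
    intro x x'
    calc ∑ r, h x r * h x' r ≤ ∑ _r : R, M ^ 2 := by
          refine Finset.sum_le_sum fun r _ => (le_abs_self _).trans ?_
          rw [abs_mul, sq]
          exact mul_le_mul (habs x r) (habs x' r) (abs_nonneg _) ((abs_nonneg _).trans (habs x r))
      _ = _ := by simp [N]
  calc _ = ∑ r, (∑ x, h x r) ^ 2 := by
        refine Finset.sum_congr rfl fun r _ => ?_
        simp only [h, H, Finset.sum_sub_distrib, mean, ← Finset.mul_sum]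
        rw [Finset.sum_comm (γ := R)]
    _ = ∑ x, ∑ x', ∑ r, h x r * h x' r := by
        simp only [sq, Finset.sum_mul_sum]
        rw [Finset.sum_comm]
        exact Finset.sum_congr rfl fun x _ => Finset.sum_comm
    -- Orthogonality leaves only the row `x = 0` and the diagonal, `2 ^ c` pairs each.
    _ ≤ ∑ x : Bits c, ∑ x' : Bits c, ((if x = 0 then N * M ^ 2 else 0) +
          if x = x' then N * M ^ 2 else 0) := by
        refine Finset.sum_le_sum fun x _ => Finset.sum_le_sum fun x' _ => ?_
        have hb := hbound x x'
        have hp : 0 ≤ N * M ^ 2 := by positivity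
        by_cases hx : x = 0
        · rw [if_pos hx]; split_ifs <;> linarith
        · by_cases hxx' : x = x'
          · rw [if_neg hx, if_pos hxx']; linarith
          · rw [if_neg hx, if_neg hxx', horth x x' hx hxx']; simp
    _ = _ := by
        simp [Finset.sum_add_distrib]
        ring

end PairwiseIndependence

/-- Weierstrass product inequality. The `a i` are not assumed to be at most one; if they sum to one
or more, the left side is not positive. -/
theorem one_sub_sum_le_prod {ι : Type*} (s : Finset ι) (f a : ι → ℝ) (hf : ∀ i, 0 ≤ f i)
    (ha : ∀ i, 0 ≤ a i) (h : ∀ i, 1 - a i ≤ f i) : 1 - ∑ i ∈ s, a i ≤ ∏ i ∈ s, f i := by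
  classical
  induction s using Finset.induction_on with
  | empty => simp
  | insert i s hi ih =>
    rw [Finset.sum_insert hi, Finset.prod_insert hi]
    have hs : 0 ≤ ∑ i ∈ s, a i := Finset.sum_nonneg fun i _ => ha i
    have hp : 0 ≤ ∏ i ∈ s, f i := Finset.prod_nonneg fun i _ => hf i
    rcases le_or_gt (1 - (a i + ∑ i ∈ s, a i)) 0 with h1 | h1
    · exact h1.trans (mul_nonneg (hf i) hp)
    · have hq : 0 ≤ 1 - ∑ i ∈ s, a i := by linarith [ha i]
      calc 1 - (a i + ∑ i ∈ s, a i) ≤ (1 - a i) * (1 - ∑ i ∈ s, a i) := by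
            nlinarith [mul_nonneg (ha i) hs]
        _ ≤ f i * ∏ i ∈ s, f i := mul_le_mul (h i) ih hq (hf i)

/-- A product of random factors that are concentrated around their means is not much smaller than
the product of the means, on all but a few points. -/
theorem sum_prod_ge {R : Type*} [Fintype R] {n : ℕ} (g : R → Fin n → ℝ) (g₀ : Fin n → ℝ)
    (hg : ∀ r i, 0 ≤ g r i) (hg₀ : ∀ i, 0 < g₀ i) {δ : ℝ}
    (hvar : ∀ i, ∑ r, (g r i - g₀ i) ^ 2 ≤ Fintype.card R * (δ * g₀ i ^ 2))
    (hδ₀ : 0 ≤ δ) (hδ : 16 * (n + 1) ^ 2 * δ ≤ 1) (bad : R → Prop) [DecidablePred bad]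
    (hbad : (∑ r, if bad r then 1 else 0 : ℝ) ≤ Fintype.card R / 8) :
    5 / 8 * (Fintype.card R * ∏ i, g₀ i) ≤ ∑ r, if bad r then 0 else ∏ i, g r i := by
  set N : ℝ := (Fintype.card R : ℝ)
  have hN : 0 ≤ N := by positivity
  have hn : (0 : ℝ) < n + 1 := by positivity
  -- With `q = n + 1`, the bound `t ≤ 1 / (8 * q) + 2 * q * t ^ 2` on a relative deviation `t`
  -- trades it for its square. Summed over the agents, each of the two terms averages to at most `1
  -- / 8`.
  let a : R → Fin n → ℝ := fun r i =>
    1 / (8 * (n + 1)) + 2 * (n + 1) * ((g r i - g₀ i) ^ 2 / g₀ i ^ 2)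
  have ha : ∀ r i, 0 ≤ a r i := fun r i => by positivity
  have hprod : ∀ r, (∏ i, g₀ i) * (1 - ∑ i, a r i) ≤ ∏ i, g r i := by
    intro r
    have h1 := one_sub_sum_le_prod Finset.univ (fun i => g r i / g₀ i) (a r)
      (fun i => div_nonneg (hg r i) (hg₀ i).le) (ha r) fun i => by
        have hi := hg₀ i
        set q := (n : ℝ) + 1
        set t := (g₀ i - g r i) / g₀ i
        have e1 : g r i / g₀ i = 1 - t := by simp only [t]; field_simp; ring
        have e2 : (g r i - g₀ i) ^ 2 / g₀ i ^ 2 = t ^ 2 := by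
          simp only [t]; rw [div_pow]; ring
        have e3 : a r i - t = 2 * q * (t - 1 / (4 * q)) ^ 2 := by
          simp only [a, e2]
          field_simp
          ring
        have e4 : 0 ≤ 2 * q * (t - 1 / (4 * q)) ^ 2 := by positivity
        rw [e1]
        linarith
    rw [Finset.prod_div_distrib, le_div_iff₀ (Finset.prod_pos fun i _ => hg₀ i)] at h1
    linarith
  have hsuma : ∑ r, ∑ i, a r i ≤ N * (1 / 4) := by
    rw [Finset.sum_comm]
    have h1 : ∀ i, ∑ r, a r i ≤ N * (1 / (8 * (n + 1)) + 2 * (n + 1) * δ) := by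
      intro i
      simp only [a, Finset.sum_add_distrib, ← Finset.mul_sum, ← Finset.sum_div, Finset.sum_const,
        Finset.card_univ, nsmul_eq_mul]
      have h2 : (∑ r, (g r i - g₀ i) ^ 2) / g₀ i ^ 2 ≤ N * δ := by
        rw [div_le_iff₀ (by have := hg₀ i; positivity)]
        linarith [hvar i]
      have : 2 * ((n : ℝ) + 1) * ((∑ r, (g r i - g₀ i) ^ 2) / g₀ i ^ 2) ≤
          2 * (n + 1) * (N * δ) := by gcongr
      have hNN : (Fintype.card R : ℝ) = N := rfl
      rw [hNN, mul_div_assoc]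
      linarith
    refine (Finset.sum_le_sum fun i _ => h1 i).trans ?_
    rw [Finset.sum_const, Finset.card_univ, Fintype.card_fin, nsmul_eq_mul]
    have h3 : (n + 1 : ℝ) * (1 / (8 * (n + 1)) + 2 * (n + 1) * δ) ≤ 1 / 4 := by
      have : (n + 1 : ℝ) * (1 / (8 * (n + 1))) = 1 / 8 := by field_simp
      nlinarith
    have h4 : (0 : ℝ) ≤ 1 / (8 * (n + 1)) + 2 * (n + 1) * δ := by positivity
    nlinarith [mul_le_mul_of_nonneg_left h3 hN, mul_nonneg hN h4]
  have hP : 0 ≤ ∏ i, g₀ i := Finset.prod_nonneg fun i _ => (hg₀ i).le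
  -- Bad points cost `1 / 8` and deviations `1 / 4`, which leaves `5 / 8`.
  calc 5 / 8 * (N * ∏ i, g₀ i)
      ≤ (∏ i, g₀ i) * (N - (∑ r, if bad r then 1 else 0 : ℝ) - ∑ r, ∑ i, a r i) := by
        nlinarith
    _ = ∑ r, (∏ i, g₀ i) * (1 - (if bad r then 1 else 0) - ∑ i, a r i) := by
        rw [← Finset.mul_sum]
        simp [Finset.sum_sub_distrib, N]
    _ ≤ _ := by
        refine Finset.sum_le_sum fun r _ => ?_
        split_ifs with h
        · have := Finset.sum_nonneg fun i (_ : i ∈ Finset.univ) => ha r i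
          nlinarith
        · simpa using hprod r

/-! ### Lower bound in the local model -/

section LocalModel

variable {c d k : ℕ}

theorem sum_if_apply_eq {J V : Type*} [Fintype J] [DecidableEq J] [Fintype V] [DecidableEq V]
    [AddCommGroup V] (o : V) (j : J) :
    (Fintype.card V : ℝ) * (∑ r : J → V, if o = r j then 1 else 0 : ℝ) = Fintype.card (J → V) := by
  have h : ∀ v : V, (∑ r : J → V, if o = r j + v then 1 else 0 : ℝ) =
      ∑ r : J → V, if o = r j then 1 else 0 := fun v =>
    Fintype.sum_equiv (Equiv.addRight (Pi.single j v)) _ _ fun r => by simp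
  calc (Fintype.card V : ℝ) * (∑ r : J → V, if o = r j then 1 else 0 : ℝ)
      = ∑ v : V, ∑ r : J → V, (if o = r j + v then 1 else 0 : ℝ) := by simp [h]
    _ = ∑ r : J → V, ∑ v : V, (if o = r j + v then 1 else 0 : ℝ) := Finset.sum_comm
    _ = ∑ r : J → V, 1 := by
        refine Finset.sum_congr rfl fun r _ => ?_
        have : ∀ v, (o = r j + v) ↔ (v = o - r j) := fun v => by
          rw [eq_sub_iff_add_eq, add_comm, eq_comm]
        simp [this]
    _ = _ := by simp

/-- The law of a sample when the strings are uniformly random. -/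
noncomputable def averageLaw (s : Fin (k + 1) → Bits d) (z : Point c d (k + 1)) : ℝ≥0∞ :=
  (Fintype.card (Bits d → Bits c) : ℝ≥0∞)⁻¹ * ∑ r : Bits d → Bits c, sampleLaw r s z

theorem sum_sampleLaw (r : Bits d → Bits c) (s : Fin (k + 1) → Bits d) :
    ∑ z, sampleLaw r s z = 1 := by
  rw [← tsum_fintype (L := .unconditional _)]; exact PMF.tsum_coe _

theorem sum_averageLaw_mul (s : Fin (k + 1) → Bits d) (G : Point c d (k + 1) → ℝ≥0∞) :
    ∑ z, averageLaw s z * G z = (Fintype.card (Bits d → Bits c) : ℝ≥0∞)⁻¹ *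
      ∑ r : Bits d → Bits c, ∑ z, sampleLaw r s z * G z := by
  simp only [averageLaw, mul_assoc, Finset.sum_mul, ← Finset.mul_sum]
  rw [Finset.sum_comm]

theorem sum_averageLaw (s : Fin (k + 1) → Bits d) :
    ∑ z : Point c d (k + 1), averageLaw s z = 1 := by
  have := sum_averageLaw_mul (c := c) s fun _ => 1
  simp only [mul_one, sum_sampleLaw] at this
  rw [this, Finset.sum_const, Finset.card_univ, nsmul_eq_mul, mul_one]
  exact ENNReal.inv_mul_cancel (by simp) (ENNReal.natCast_ne_top _)

theorem toReal_sum_averageLaw_mul (s : Fin (k + 1) → Bits d) (G : Point c d (k + 1) → ℝ≥0∞)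
    (hG : ∀ z, G z ≤ 1) :
    (∑ z, averageLaw s z * G z).toReal = (Fintype.card (Bits d → Bits c) : ℝ)⁻¹ *
      ∑ r : Bits d → Bits c, (∑ z, sampleLaw r s z * G z).toReal := by
  have hfin : ∀ r : Bits d → Bits c, ∑ z, sampleLaw r s z * G z ≠ ∞ := fun r =>
    ne_top_of_le_ne_top ENNReal.one_ne_top <| by
      rw [← sum_sampleLaw r s]
      exact Finset.sum_le_sum fun z _ => mul_le_of_le_one_right' (hG z)
  rw [sum_averageLaw_mul, ENNReal.toReal_mul, ENNReal.toReal_inv, ENNReal.toReal_natCast,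
    ENNReal.toReal_sum fun r _ => hfin r]

/-- For a private answer, the probability of the answer is nearly the same for most strings. -/
theorem sum_sq_answer_le (s : Fin (k + 1) → Bits d) (G : Point c d (k + 1) → ℝ≥0∞)
    (hG : ∀ z, G z ≤ 1) (hdp : ∀ z z', G z ≤ ENNReal.ofReal (Real.exp (1 / 4)) * G z') :
    ∑ r : Bits d → Bits c, ((∑ z, sampleLaw r s z * G z).toReal -
        (∑ z, averageLaw s z * G z).toReal) ^ 2 ≤
      Fintype.card (Bits d → Bits c) *
        ((2 ^ c : ℝ)⁻¹ * (∑ z, averageLaw s z * G z).toReal ^ 2) := by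
  set g₀ := (∑ z, averageLaw s z * G z).toReal with hg₀
  have hGfin : ∀ z, G z ≠ ∞ := fun z => ne_top_of_le_ne_top ENNReal.one_ne_top (hG z)
  have hexp : Real.exp (1 / 4) ≤ 4 / 3 := by
    have := Real.exp_bound_div_one_sub_of_interval (x := 1 / 4) (by norm_num) (by norm_num)
    norm_num at this ⊢
    linarith
  have hfin₀ : ∑ z, averageLaw s z * G z ≠ ∞ := ne_top_of_le_ne_top ENNReal.one_ne_top <| by
    rw [← sum_averageLaw (c := c) s]
    exact Finset.sum_le_sum fun z _ => mul_le_of_le_one_right' (hG z)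
  -- Privacy keeps every value of `G` within a factor `4 / 3` of its average, so the variance bound
  -- becomes relative to `g₀`.
  have hM : ∀ z, (G z).toReal ≤ 4 / 3 * g₀ := by
    intro z
    have h1 : G z ≤ ENNReal.ofReal (4 / 3) * ∑ z', averageLaw s z' * G z' := by
      calc G z = ∑ z' : Point c d (k + 1), averageLaw s z' * G z := by
            rw [← Finset.sum_mul, sum_averageLaw, one_mul]
        _ ≤ ∑ z' : Point c d (k + 1), averageLaw s z' * (ENNReal.ofReal (4 / 3) * G z') := by
            gcongr with z' _
            exact (hdp z z').trans (by gcongr)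
        _ = _ := by
            rw [Finset.mul_sum]
            exact Finset.sum_congr rfl fun _ _ => by ring
    have h2 := ENNReal.toReal_mono (ENNReal.mul_ne_top ENNReal.ofReal_ne_top hfin₀) h1
    rwa [ENNReal.toReal_mul, ENNReal.toReal_ofReal (by norm_num)] at h2
  set N : ℝ := (Fintype.card (Bits d → Bits c) : ℝ) with hNdef
  have hN : 0 < N := by rw [hNdef]; exact_mod_cast Fintype.card_pos
  let A : (Bits d → Bits c) → ℝ := fun r => ∑ x, (G (.inl (x, fun j => x ⬝ᵥ r j))).toReal
  -- The share points contribute a constant `κ` that does not depend on the strings, so only the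
  -- labelled points vary.
  obtain ⟨κ, hκ⟩ : ∃ κ : ℝ, ∀ r : Bits d → Bits c, (∑ z, sampleLaw r s z * G z).toReal =
      (2 * 2 ^ c)⁻¹ * A r + κ := by
    refine ⟨(2⁻¹ * ((k + 1 : ℝ≥0∞)⁻¹ * ∑ t, G (.inr (t, s t)))).toReal, fun r => ?_⟩
    have hf1 : ∑ x, G (.inl (x, fun j => x ⬝ᵥ r j)) ≠ ∞ :=
      ENNReal.sum_ne_top.2 fun x _ => hGfin _
    have hf2 : ∑ t, G (.inr (t, s t)) ≠ ∞ := ENNReal.sum_ne_top.2 fun x _ => hGfin _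
    rw [sum_sampleLaw_mul, ENNReal.toReal_add]
    · congr 1
      rw [ENNReal.toReal_mul, ENNReal.toReal_mul, ENNReal.toReal_sum fun x _ => hGfin _]
      simp [A, mul_assoc, mul_comm]
    · exact ENNReal.mul_ne_top (by simp) (ENNReal.mul_ne_top (by simp) hf1)
    · exact ENNReal.mul_ne_top (by simp) (ENNReal.mul_ne_top (by simp) hf2)
  have hg₀' : g₀ = (2 * 2 ^ c)⁻¹ * (N⁻¹ * ∑ r, A r) + κ := by
    rw [hg₀, toReal_sum_averageLaw_mul s G hG]
    simp only [hκ, Finset.sum_add_distrib, ← Finset.mul_sum, Finset.sum_const, Finset.card_univ,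
      nsmul_eq_mul]
    rw [mul_add, ← hNdef, inv_mul_cancel_left₀ hN.ne']
    ring
  have hvar := sum_sq_dotProduct_le (c := c) (d := d)
    (fun x b => (G (.inl (x, b))).toReal) (M := 4 / 3 * g₀)
    (fun _ _ => ENNReal.toReal_nonneg) fun _ _ => hM _
  have hpow : (0 : ℝ) < 2 ^ c := by positivity
  calc ∑ r : Bits d → Bits c, ((∑ z, sampleLaw r s z * G z).toReal - g₀) ^ 2
      = ((2 * 2 ^ c)⁻¹) ^ 2 * ∑ r, (A r - N⁻¹ * ∑ r', A r') ^ 2 := by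
        rw [Finset.mul_sum]
        refine Finset.sum_congr rfl fun r _ => ?_
        rw [hκ, hg₀', ← mul_pow]
        ring
    _ ≤ ((2 * 2 ^ c)⁻¹) ^ 2 * (N * (2 * 2 ^ c * (4 / 3 * g₀) ^ 2)) := by gcongr
    _ = N * ((2 ^ c)⁻¹ * g₀ ^ 2) * (8 / 9) := by field_simp; ring
    _ ≤ N * ((2 ^ c)⁻¹ * g₀ ^ 2) := by
        have : 0 ≤ N * ((2 ^ c)⁻¹ * g₀ ^ 2) := by positivity
        linarith

/-- With few agents, a fixed transcript is nearly as likely for most strings as on average, and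
the guess made from it is wrong for most strings. -/
theorem sum_prod_answer_ge {n : ℕ} (hn : 16 * (n + 1) ^ 2 ≤ 2 ^ c) (s : Fin (k + 1) → Bits d)
    (G : Fin n → Point c d (k + 1) → ℝ≥0∞) (hG : ∀ i z, G i z ≤ 1)
    (hdp : ∀ i z z', G i z ≤ ENNReal.ofReal (Real.exp (1 / 4)) * G i z') (o : Bits c)
    (j : Bits d) :
    ENNReal.ofReal (5 / 8) *
        (Fintype.card (Bits d → Bits c) * ∏ i, ∑ z, averageLaw s z * G i z) ≤
      ∑ r : Bits d → Bits c, if o = r j then 0 else ∏ i, ∑ z, sampleLaw r s z * G i z := by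
  have hfin₀ : ∀ i, ∑ z, averageLaw s z * G i z ≠ ∞ := fun i =>
    ne_top_of_le_ne_top ENNReal.one_ne_top <| by
      rw [← sum_averageLaw (c := c) s]
      exact Finset.sum_le_sum fun z _ => mul_le_of_le_one_right' (hG i z)
  have hfin : ∀ (r : Bits d → Bits c) i, ∑ z, sampleLaw r s z * G i z ≠ ∞ := fun r i =>
    ne_top_of_le_ne_top ENNReal.one_ne_top <| by
      rw [← sum_sampleLaw r s]
      exact Finset.sum_le_sum fun z _ => mul_le_of_le_one_right' (hG i z)
  -- The relative estimate needs positive means; if one vanishes, the left side is zero.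
  by_cases h0 : ∃ i, ∑ z, averageLaw s z * G i z = 0
  · obtain ⟨i, hi⟩ := h0
    rw [Finset.prod_eq_zero (Finset.mem_univ i) hi]
    simp
  push Not at h0
  have hn' : (16 : ℝ) * (n + 1) ^ 2 ≤ 2 ^ c := by exact_mod_cast hn
  have hpow : (0 : ℝ) < 2 ^ c := by positivity
  -- The relative variance `2 ^ (-c)` turns the hypothesis on `n` into the required smallness. The
  -- guess is right for a fraction `2 ^ (-c) ≤ 1 / 8` of the strings.
  have key := sum_prod_ge (fun (r : Bits d → Bits c) i => (∑ z, sampleLaw r s z * G i z).toReal)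
    (fun i => (∑ z, averageLaw s z * G i z).toReal) (fun _ _ => ENNReal.toReal_nonneg)
    (fun i => ENNReal.toReal_pos (h0 i) (hfin₀ i)) (δ := (2 ^ c : ℝ)⁻¹)
    (fun i => sum_sq_answer_le s (G i) (hG i) (hdp i)) (by positivity)
    (by rw [mul_inv_le_iff₀ hpow]; linarith) (fun r => o = r j)
    (by
      have h := sum_if_apply_eq o j
      have hc : (Fintype.card (Bits c) : ℝ) = 2 ^ c := by simp
      rw [hc] at h
      set b : ℝ := ∑ r : Bits d → Bits c, if o = r j then 1 else 0
      have hb : 0 ≤ b := Finset.sum_nonneg fun r _ => by split_ifs <;> norm_num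
      rw [← h]
      have h8 : (8 : ℝ) ≤ 2 ^ c := by nlinarith [Nat.cast_nonneg (α := ℝ) n]
      nlinarith [mul_le_mul_of_nonneg_right h8 hb])
  have := ENNReal.ofReal_le_ofReal key
  rw [ENNReal.ofReal_mul (by norm_num), ENNReal.ofReal_mul (by positivity),
    ENNReal.ofReal_natCast, ENNReal.ofReal_prod_of_nonneg fun _ _ => ENNReal.toReal_nonneg,
    ENNReal.ofReal_sum_of_nonneg fun r _ => by
      split_ifs
      · exact le_rfl
      · exact Finset.prod_nonneg fun _ _ => ENNReal.toReal_nonneg] at this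
  simp only [ENNReal.ofReal_toReal (hfin₀ _)] at this
  refine this.trans (le_of_eq (Finset.sum_congr rfl fun r _ => ?_))
  split_ifs
  · simp
  · rw [ENNReal.ofReal_prod_of_nonneg fun _ _ => ENNReal.toReal_nonneg]
    simp only [ENNReal.ofReal_toReal (hfin r _)]

theorem sum_prod_mul_prod {X : Type*} [Fintype X] {n : ℕ} (p : X → ℝ≥0∞)
    (G : Fin n → X → ℝ≥0∞) (a : ℝ≥0∞) :
    ∑ y : Fin n → X, (∏ i, p (y i)) * (a * ∏ i, G i (y i)) = a * ∏ i, ∑ z, p z * G i z := by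
  rw [Finset.prod_univ_sum, Fintype.piFinset_univ, Finset.mul_sum]
  refine Finset.sum_congr rfl fun y _ => ?_
  rw [Finset.prod_mul_distrib]
  ring

theorem sum_prod_eq_one {X : Type*} [Fintype X] {n : ℕ} {p : X → ℝ≥0∞} (hp : ∑ z, p z = 1) :
    ∑ y : Fin n → X, ∏ i, p (y i) = 1 := by
  have := sum_prod_mul_prod (n := n) p (fun _ _ => 1) 1
  simpa [hp] using this

/-- In the local model a private protocol for the task needs exponentially many agents, whatever
the number of rounds: the probability of a transcript is a product over the agents, and by privacy
each factor is nearly the same for most choices of the strings. -/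
theorem two_pow_lt_of_local {n : ℕ} {σ : List Round}
    (P : Protocol (Point c d (k + 1)) (Bits c) σ 0 n) (hP : P.IsPrivate (1 / 4))
    (hsol : SolvesOneOutOfParity P (1 / 4)) : 2 ^ c < 16 * (n + 1) ^ 2 := by
  classical
  by_contra! hn
  -- Even with known shares the task is hard; only the strings are randomized.
  let s : Fin (k + 1) → Bits d := 0
  let j : Bits d := ∑ t, s t
  let x : Fin 0 → Point c d (k + 1) := Fin.elim0
  set N : ℝ≥0∞ := (Fintype.card (Bits d → Bits c) : ℝ≥0∞) with hN
  have hN0 : N ≠ 0 := by simp [hN]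
  have hNtop : N ≠ ∞ := ENNReal.natCast_ne_top _
  -- Independent inputs meet a product over the agents, so averaging over samples acts inside each
  -- factor.
  have hview : ∀ (ρ : P.RefCoins) (p : Point c d (k + 1) → ℝ≥0∞) (q : P.View → Prop)
      [DecidablePred q],
      ∑ y : Fin n → Point c d (k + 1), (∏ i, p (y i)) *
        ∑' B : P.View, (if P.shape B = σ.reverse ∧ q B then P.viewProb ρ x y B else 0) =
      ∑' B : P.View, if P.shape B = σ.reverse ∧ q B then
        P.curator.law (P.curator.consistent x (P.curatorLog ρ B)) * ∏ i, ∑ z, p z *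
          (P.agent i).law ((P.agent i).consistent (fun _ => z) (P.agentLog ρ i B)) else 0 := by
    intro ρ p q _
    simp only [← ENNReal.tsum_mul_left]
    rw [← Summable.tsum_finsetSum fun _ _ => ENNReal.summable]
    refine tsum_congr fun B => ?_
    split_ifs
    · exact sum_prod_mul_prod p (fun i z =>
        (P.agent i).law ((P.agent i).consistent (fun _ => z) (P.agentLog ρ i B))) _
    · simp
  have hρ : ∀ ρ : P.RefCoins, ∑ r : Bits d → Bits c, ∑ y : Fin n → Point c d (k + 1),
      (∏ i, sampleLaw r s (y i)) * P.partyLaw {ω | P.result x y (ρ, ω) = r j} ≤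
        N * ENNReal.ofReal (3 / 8) := by
    intro ρ
    let o : P.View → Bits c := fun B => P.output ρ B.reverse
    let C : P.View → ℝ≥0∞ := fun B => P.curator.law (P.curator.consistent x (P.curatorLog ρ B))
    let G : P.View → Fin n → Point c d (k + 1) → ℝ≥0∞ := fun B i z =>
      (P.agent i).law ((P.agent i).consistent (fun _ => z) (P.agentLog ρ i B))
    have hsucc : ∀ r : Bits d → Bits c, ∑ y : Fin n → Point c d (k + 1),
        (∏ i, sampleLaw r s (y i)) * P.partyLaw {ω | P.result x y (ρ, ω) = r j} =
        ∑' B : P.View, if P.shape B = σ.reverse ∧ o B = r j then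
          C B * ∏ i, ∑ z, sampleLaw r s z * G B i z else 0 := by
      intro r
      refine Eq.trans ?_ (hview ρ (fun z => sampleLaw r s z) fun B => o B = r j)
      refine Finset.sum_congr rfl fun y _ => ?_
      simp only [Protocol.result_eq]
      rw [P.partyLaw_revRun ρ x y σ.reverse fun B => o B = r j]
      congr!
    have htotal : ∀ p : Point c d (k + 1) → ℝ≥0∞, ∑ z, p z = 1 →
        (∑' B : P.View, if P.shape B = σ.reverse then
          C B * ∏ i, ∑ z, p z * G B i z else 0) = 1 := by
      intro p hp
      have := hview ρ p fun _ => True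
      simp only [and_true] at this
      rw [← this]
      simp only [P.tsum_viewProb, mul_one]
      exact sum_prod_eq_one hp
    have hsplit : ∀ r : Bits d → Bits c,
        (∑' B : P.View, if P.shape B = σ.reverse ∧ o B = r j then
          C B * ∏ i, ∑ z, sampleLaw r s z * G B i z else 0) +
        (∑' B : P.View, if P.shape B = σ.reverse then
          C B * (if o B = r j then 0 else ∏ i, ∑ z, sampleLaw r s z * G B i z) else 0) = 1 := by
      intro r
      rw [← htotal (fun z => sampleLaw r s z) (sum_sampleLaw r s), ← ENNReal.tsum_add]
      refine tsum_congr fun B => ?_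
      by_cases h1 : P.shape B = σ.reverse <;> by_cases h2 : o B = r j <;> simp [h1, h2]
    -- Each view fails on at least `5 / 8` of its averaged weight, and the averaged weights sum to
    -- one; success has probability at most `3 / 8` over random strings.
    have hfail : N * ENNReal.ofReal (5 / 8) ≤ ∑ r : Bits d → Bits c,
        ∑' B : P.View, if P.shape B = σ.reverse then
          C B * (if o B = r j then 0 else ∏ i, ∑ z, sampleLaw r s z * G B i z) else 0 := by
      rw [← Summable.tsum_finsetSum fun _ _ => ENNReal.summable]
      calc N * ENNReal.ofReal (5 / 8) = N * ENNReal.ofReal (5 / 8) *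
            ∑' B : P.View, if P.shape B = σ.reverse then
              C B * ∏ i, ∑ z, averageLaw s z * G B i z else 0 := by
            rw [htotal _ (sum_averageLaw s), mul_one]
        _ ≤ _ := by
            rw [← ENNReal.tsum_mul_left]
            refine ENNReal.tsum_le_tsum fun B => ?_
            split_ifs with hB
            · have := sum_prod_answer_ge hn s (G B) (fun i z => prob_le_one)
                (fun i z z' => (hP.2 i).law_consistent_le
                  (Or.inr ⟨0, fun j hj => (hj (Subsingleton.elim _ _)).elim⟩)
                  (by rw [P.length_agentLog, hB, List.count_reverse])) (o B) j
              rw [← Finset.mul_sum]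
              calc _ = C B * (ENNReal.ofReal (5 / 8) *
                    (N * ∏ i, ∑ z, averageLaw s z * G B i z)) := by ring
                _ ≤ _ := by gcongr
            · simp
    simp only [hsucc]
    have hsum := Finset.sum_congr (rfl : (Finset.univ : Finset (Bits d → Bits c)) = Finset.univ)
      fun r _ => hsplit r
    rw [Finset.sum_add_distrib, Finset.sum_const, Finset.card_univ, nsmul_eq_mul, mul_one,
      ← hN] at hsum
    have h58 : N * ENNReal.ofReal (3 / 8) + N * ENNReal.ofReal (5 / 8) = N := by
      rw [← mul_add, ← ENNReal.ofReal_add (by norm_num) (by norm_num)]; norm_num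
    have hle := (add_le_add le_rfl hfail).trans (hsum.trans h58.symm).le
    exact (ENNReal.add_le_add_iff_right (ENNReal.mul_ne_top hNtop ENNReal.ofReal_ne_top)).1 hle
  have hall : N * ENNReal.ofReal (1 - 1 / 4) ≤ N * ENNReal.ofReal (3 / 8) := by
    calc N * ENNReal.ofReal (1 - 1 / 4) = ∑ _r : Bits d → Bits c, ENNReal.ofReal (1 - 1 / 4) := by
          simp [hN]
      _ ≤ ∑ r : Bits d → Bits c, ∑ y : Fin n → Point c d (k + 1), (∏ i, sampleLaw r s (y i)) *
            P.outputProb x y (r j) := by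
          refine Finset.sum_le_sum fun r _ => (hsol r s).trans (le_of_eq ?_)
          rw [Fintype.sum_unique]
          refine Finset.sum_congr rfl fun y _ => ?_
          rw [Finset.univ_eq_empty (α := Fin 0), Finset.prod_empty, one_mul]
          exact congrArg (fun x => _ * P.outputProb x y (r j)) (Subsingleton.elim _ _)
      _ ≤ ∑ r : Bits d → Bits c, ∑ y : Fin n → Point c d (k + 1), ∫⁻ ρ,
            (∏ i, sampleLaw r s (y i)) * P.partyLaw {ω | P.result x y (ρ, ω) = r j} ∂P.refLaw := by
          refine Finset.sum_le_sum fun r _ => Finset.sum_le_sum fun y _ => ?_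
          rw [P.outputProb_eq_lintegral]
          exact lintegral_const_mul_le _ _
      _ ≤ ∫⁻ ρ, ∑ r : Bits d → Bits c, ∑ y : Fin n → Point c d (k + 1),
            (∏ i, sampleLaw r s (y i)) * P.partyLaw {ω | P.result x y (ρ, ω) = r j} ∂P.refLaw :=
          (Finset.sum_le_sum fun r _ => sum_lintegral_le _ _ _).trans (sum_lintegral_le _ _ _)
      _ ≤ ∫⁻ _ρ, N * ENNReal.ofReal (3 / 8) ∂P.refLaw := lintegral_mono hρ
      _ = _ := by simp
  have := (ENNReal.mul_le_mul_iff_right hN0 hNtop).1 hall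
  rw [ENNReal.ofReal_le_ofReal_iff (by norm_num)] at this
  norm_num at this

end LocalModel

/-! ### Parties built from randomized kernels -/

section Kernel

variable {X Msg : Type} {ℓ : ℕ}

/-- In a single exchange it suffices to compare the probabilities of single answers. -/
theorem Party.isPrivate_one [Countable Msg] {P : Party X ℓ Msg} {ε : ℝ}
    (h : ∀ x x', Neighboring x x' → ∀ q w, P.law {ω | P.reply x ω [q] = w} ≤
      ENNReal.ofReal (Real.exp ε) * P.law {ω | P.reply x' ω [q] = w}) : P.IsPrivate 1 ε := by
  intro A x x' hx S hS
  -- With countably many messages, one exchange splits into rectangles indexed by query and answer,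
  -- and only the party's side depends on the input.
  have key : ∀ z, A.outputProb P 1 z S = ∑' p : Msg × Msg,
      A.law ({a | A.query a [] = p.1} ∩ (fun a => A.output a [p.2]) ⁻¹' S) *
        P.law {ω | P.reply z ω [p.1] = p.2} := by
    intro z
    have hset : {ω : A.Coins × P.Coins | A.output ω.1 (P.interact z ω.2 (A.query ω.1) 1).2 ∈ S} =
        ⋃ p : Msg × Msg, ({a | A.query a [] = p.1} ∩ (fun a => A.output a [p.2]) ⁻¹' S) ×ˢ
          {ω | P.reply z ω [p.1] = p.2} := by
      ext ω
      simp [Party.interact, and_assoc]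
    rw [Adversary.outputProb, hset, measure_iUnion]
    · exact tsum_congr fun p => Measure.prod_prod _ _
    · intro p p' hp
      rw [Function.onFun, Set.disjoint_left]
      rintro ω ⟨⟨h1, -⟩, h2⟩ ⟨⟨h1', -⟩, h2'⟩
      simp only [Set.mem_ofPred_eq] at h1 h2 h1' h2'
      have e1 := h1.symm.trans h1'
      rw [← e1] at h2'
      exact hp (Prod.ext e1 (h2.symm.trans h2'))
    · exact fun p => ((A.measurableSet_query _ _).inter (A.measurable_output _ hS)).prod
        (P.measurableSet_reply _ _ _)
  rw [key, key, ← ENNReal.tsum_mul_left]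
  refine ENNReal.tsum_le_tsum fun p => ?_
  rw [mul_left_comm]
  gcongr
  exact h x x' hx _ _

/-- The party that on input `x` and messages `h` answers with a sample from `κ x (f h)`; its coins
are independent samples for all arguments of `κ`. -/
noncomputable def Party.ofKernel {Q R : Type} [Fintype X] [Fintype Q]
    (κ : (Fin ℓ → X) → Q → PMF R) (f : List Msg → Q) (e : R → Msg) : Party X ℓ Msg :=
  letI : MeasurableSpace R := ⊤
  { Coins := (Fin ℓ → X) × Q → R
    law := Measure.pi fun p => (κ p.1 p.2).toMeasure
    reply := fun x ω h => e (ω (x, f h))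
    measurableSet_reply := fun x h v =>
      have hv : MeasurableSet {r | e r = v} := MeasurableSpace.measurableSet_top
      have hm : Measurable fun ω : (Fin ℓ → X) × Q → R => ω (x, f h) := measurable_pi_apply _
      hm hv }

theorem Party.ofKernel_law {Q R : Type} [Fintype X] [Fintype Q]
    (κ : (Fin ℓ → X) → Q → PMF R) (f : List Msg → Q) (e : R → Msg) (x : Fin ℓ → X)
    (h : List Msg) (w : Msg) :
    (Party.ofKernel κ f e).law {ω | (Party.ofKernel κ f e).reply x ω h = w} =
      (κ x (f h)).toOuterMeasure {v | e v = w} := by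
  let _ : MeasurableSpace R := ⊤
  have hw : MeasurableSet {r | e r = w} := MeasurableSpace.measurableSet_top
  have hm := (measurePreserving_eval (fun p : (Fin ℓ → X) × Q => (κ p.1 p.2).toMeasure)
    (x, f h)).measure_preimage hw.nullMeasurableSet
  rw [PMF.toMeasure_apply_eq_toOuterMeasure_apply _ hw] at hm
  exact hm

theorem Party.ofKernel_law_apply {Q R : Type} [Fintype X] [Fintype Q]
    (κ : (Fin ℓ → X) → Q → PMF R) (f : List Msg → Q) {e : R → Msg} (he : Function.Injective e)
    (x : Fin ℓ → X) (h : List Msg) (v : R) :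
    (Party.ofKernel κ f e).law {ω | (Party.ofKernel κ f e).reply x ω h = e v} =
      κ x (f h) v := by
  have : {v' | e v' = e v} = {v} := by ext; simp [he.eq_iff]
  rw [Party.ofKernel_law, this, PMF.toOuterMeasure_apply_singleton]

theorem Party.ofKernel_isPrivate_one {Q R : Type} [Fintype X] [Fintype Q] [Countable Msg]
    {κ : (Fin ℓ → X) → Q → PMF R} {ε : ℝ}
    (hκ : ∀ x x', Neighboring x x' → ∀ q v,
      κ x q v ≤ ENNReal.ofReal (Real.exp ε) * κ x' q v) (f : List Msg → Q) (e : R → Msg) :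
    (Party.ofKernel κ f e).IsPrivate 1 ε := by
  refine Party.isPrivate_one fun x x' hx q w => ?_
  rw [Party.ofKernel_law, Party.ofKernel_law, PMF.toOuterMeasure_apply, PMF.toOuterMeasure_apply,
    ← ENNReal.tsum_mul_left]
  refine ENNReal.tsum_le_tsum fun v => ?_
  by_cases hv : v ∈ {v | e v = w}
  · simpa [Set.indicator_of_mem hv] using hκ x x' hx _ v
  · simp [Set.indicator_of_notMem hv]

end Kernel

/-! ### The curator's mechanism -/

section ExponentialMechanism

variable {c d k ℓ : ℕ}

/-- The penalty of the candidate `v` for the string `r j` at one sample. -/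
noncomputable def penalty (j : Bits d) (v : Bits c) : Point c d (k + 1) → ℝ≥0∞
  | .inl z => if z.1 ⬝ᵥ v = z.2 j then 1 else ENNReal.ofReal (8 / 9)
  | .inr _ => 1

theorem penalty_le_one (j : Bits d) (v : Bits c) (z : Point c d (k + 1)) : penalty j v z ≤ 1 := by
  rcases z with z | z
  · simp only [penalty]
    split_ifs
    · exact le_rfl
    · rw [← ENNReal.ofReal_one]; exact ENNReal.ofReal_le_ofReal (by norm_num)
  · exact le_rfl

theorem le_penalty (j : Bits d) (v : Bits c) (z : Point c d (k + 1)) :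
    ENNReal.ofReal (8 / 9) ≤ penalty j v z := by
  have : ENNReal.ofReal (8 / 9) ≤ 1 := by
    rw [← ENNReal.ofReal_one]; exact ENNReal.ofReal_le_ofReal (by norm_num)
  rcases z with z | z
  · simp only [penalty]
    split_ifs
    · exact this
    · exact le_rfl
  · exact this

/-- The weight of the candidate `v` for the string `r j`. -/
noncomputable def weight (x : Fin ℓ → Point c d (k + 1)) (j : Bits d) (v : Bits c) : ℝ≥0∞ :=
  ∏ i, penalty j v (x i)

theorem weight_le_one (x : Fin ℓ → Point c d (k + 1)) (j : Bits d) (v : Bits c) :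
    weight x j v ≤ 1 := Finset.prod_le_one' fun i _ => penalty_le_one j v (x i)

theorem weight_ne_zero (x : Fin ℓ → Point c d (k + 1)) (j : Bits d) (v : Bits c) :
    weight x j v ≠ 0 :=
  Finset.prod_ne_zero_iff.2 fun i _ => ((by norm_num : (0 : ℝ≥0∞) < ENNReal.ofReal (8 / 9)).trans_le
    (le_penalty j v (x i))).ne'

theorem tsum_weight_ne_zero (x : Fin ℓ → Point c d (k + 1)) (j : Bits d) :
    ∑' v, weight x j v ≠ 0 := fun h =>
  weight_ne_zero x j 0 (ENNReal.tsum_eq_zero.1 h 0)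

theorem tsum_weight_ne_top (x : Fin ℓ → Point c d (k + 1)) (j : Bits d) :
    ∑' v, weight x j v ≠ ∞ := by
  rw [tsum_fintype]
  exact ENNReal.sum_ne_top.2 fun v _ =>
    ne_top_of_le_ne_top ENNReal.one_ne_top (weight_le_one x j v)

/-- The exponential mechanism for learning the string `r j`. -/
noncomputable def expMechanism (x : Fin ℓ → Point c d (k + 1)) (j : Bits d) : PMF (Bits c) :=
  PMF.normalize (weight x j) (tsum_weight_ne_zero x j) (tsum_weight_ne_top x j)

/-- Only one factor changes, and it lies between `8 / 9` and `1`. -/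
theorem weight_le_of_neighboring {x x' : Fin ℓ → Point c d (k + 1)} (h : Neighboring x x')
    (j : Bits d) (v : Bits c) : weight x j v ≤ ENNReal.ofReal (9 / 8) * weight x' j v := by
  have h98 : (1 : ℝ≥0∞) ≤ ENNReal.ofReal (9 / 8) := by
    rw [← ENNReal.ofReal_one]; exact ENNReal.ofReal_le_ofReal (by norm_num)
  rcases h with rfl | ⟨i, hi⟩
  · exact le_mul_of_one_le_left' h98
  · rw [weight, weight, ← Finset.mul_prod_erase _ _ (Finset.mem_univ i),
      ← Finset.mul_prod_erase _ (fun i => penalty j v (x' i)) (Finset.mem_univ i), ← mul_assoc]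
    have e1 : ∏ i ∈ Finset.univ.erase i, penalty j v (x i) =
        ∏ i ∈ Finset.univ.erase i, penalty j v (x' i) :=
      Finset.prod_congr rfl fun l hl => by rw [hi l (Finset.ne_of_mem_erase hl)]
    rw [e1]
    gcongr
    refine (penalty_le_one j v (x i)).trans ?_
    have : (1 : ℝ≥0∞) = ENNReal.ofReal (9 / 8) * ENNReal.ofReal (8 / 9) := by
      rw [← ENNReal.ofReal_mul (by norm_num)]; norm_num
    rw [this]
    gcongr
    exact le_penalty j v (x' i)

theorem neighboring_symm {X : Type} {x x' : Fin ℓ → X} (h : Neighboring x x') :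
    Neighboring x' x := by
  rcases h with rfl | ⟨i, hi⟩
  · exact Or.inl rfl
  · exact Or.inr ⟨i, fun j hj => (hi j hj).symm⟩

/-- The weight and the normalization each cost `9 / 8`, and `(9 / 8) ^ 2 ≤ 1 + 1 / 4 + 1 / 32 ≤ exp
(1 / 4)`. -/
theorem expMechanism_le {x x' : Fin ℓ → Point c d (k + 1)} (h : Neighboring x x') (j : Bits d)
    (v : Bits c) : expMechanism x j v ≤
      ENNReal.ofReal (Real.exp (1 / 4)) * expMechanism x' j v := by
  have h1 := weight_le_of_neighboring h j v
  have h2 : (∑' v, weight x j v)⁻¹ ≤ ENNReal.ofReal (9 / 8) * (∑' v, weight x' j v)⁻¹ := by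
    have h3 : ∑' v, weight x' j v ≤ ENNReal.ofReal (9 / 8) * ∑' v, weight x j v := by
      rw [← ENNReal.tsum_mul_left]
      exact ENNReal.tsum_le_tsum fun v => weight_le_of_neighboring (neighboring_symm h) j v
    rw [← div_eq_mul_inv, ENNReal.le_div_iff_mul_le (Or.inl (tsum_weight_ne_zero x' j))
      (Or.inl (tsum_weight_ne_top x' j)), mul_comm, ← div_eq_mul_inv]
    exact ENNReal.div_le_of_le_mul h3
  have h4 : ENNReal.ofReal (9 / 8) * ENNReal.ofReal (9 / 8) ≤
      ENNReal.ofReal (Real.exp (1 / 4)) := by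
    rw [← ENNReal.ofReal_mul (by norm_num)]
    refine ENNReal.ofReal_le_ofReal ?_
    have := Real.quadratic_le_exp_of_nonneg (x := 1 / 4) (by norm_num)
    norm_num at this ⊢
    linarith
  rw [expMechanism, expMechanism, PMF.normalize_apply, PMF.normalize_apply]
  calc _ ≤ (ENNReal.ofReal (9 / 8) * weight x' j v) *
        (ENNReal.ofReal (9 / 8) * (∑' v, weight x' j v)⁻¹) := mul_le_mul' h1 h2
    _ = ENNReal.ofReal (9 / 8) * ENNReal.ofReal (9 / 8) *
        (weight x' j v * (∑' v, weight x' j v)⁻¹) := by ring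
    _ ≤ _ := by gcongr

/-- A candidate violated by no sample has weight one, so the normalizing sum is at least one and the
failure probability is at most the total weight of the others. -/
theorem one_le_expMechanism_add {x : Fin ℓ → Point c d (k + 1)} {j : Bits d} {v : Bits c}
    (hv : weight x j v = 1) :
    1 ≤ expMechanism x j v + ∑ v' ∈ Finset.univ.erase v, weight x j v' := by
  rw [expMechanism, PMF.normalize_apply, hv, one_mul]
  have hZ : ∑' v', weight x j v' = 1 + ∑ v' ∈ Finset.univ.erase v, weight x j v' := by
    rw [tsum_fintype, ← Finset.add_sum_erase _ _ (Finset.mem_univ v), hv]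
  set a := ∑ v' ∈ Finset.univ.erase v, weight x j v'
  set Z := ∑' v', weight x j v' with hZdef
  have hZ1 : Z⁻¹ ≤ 1 := by
    rw [ENNReal.inv_le_one, hZ]; exact le_self_add
  calc (1 : ℝ≥0∞) = Z⁻¹ * Z :=
        (ENNReal.inv_mul_cancel (tsum_weight_ne_zero x j) (tsum_weight_ne_top x j)).symm
    _ = Z⁻¹ + Z⁻¹ * a := by rw [hZ, mul_add, mul_one]
    _ ≤ _ := by gcongr; exact mul_le_of_le_one_left' hZ1

/-- Flipping a coordinate of `x` in which `v` and `w` differ exchanges the two cases. -/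
theorem sum_dotProduct_ite {v w : Bits c} (h : v ≠ w) (a b : ℝ≥0∞) :
    2 * ∑ x : Bits c, (if x ⬝ᵥ v = x ⬝ᵥ w then a else b) = 2 ^ c * (a + b) := by
  have h01 : ∀ p q p' q' : ZMod 2, p' ≠ q' → ((p + p' = q + q') ↔ ¬ p = q) := by decide
  obtain ⟨i, hi⟩ := Function.ne_iff.1 h
  have e : ∑ x : Bits c, (if (x + Pi.single i 1) ⬝ᵥ v = (x + Pi.single i 1) ⬝ᵥ w then a else b) =
      ∑ x : Bits c, (if x ⬝ᵥ v = x ⬝ᵥ w then a else b) :=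
    Fintype.sum_equiv (Equiv.addRight (Pi.single i 1 : Bits c)) _ _ fun _ => rfl
  rw [two_mul]
  nth_rewrite 2 [← e]
  rw [← Finset.sum_add_distrib]
  have : ∀ x : Bits c, ((if x ⬝ᵥ v = x ⬝ᵥ w then a else b) +
      if (x + Pi.single i 1) ⬝ᵥ v = (x + Pi.single i 1) ⬝ᵥ w then a else b) = a + b := by
    intro x
    simp only [add_dotProduct, single_dotProduct, one_mul, h01 _ _ _ _ hi]
    split_ifs <;> first | rfl | exact add_comm _ _
  rw [Finset.sum_congr rfl fun x _ => this x]
  simp [mul_add]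

/-- A sample is labelled with probability `1 / 2` and then violates a wrong candidate with
probability `1 / 2`, which gives `1 - (1 / 4) * (1 / 9)`. -/
theorem sum_sampleLaw_mul_penalty (r : Bits d → Bits c) (s : Fin (k + 1) → Bits d) (j : Bits d)
    {v : Bits c} (hv : v ≠ r j) :
    ∑ z, sampleLaw r s z * penalty j v z = ENNReal.ofReal (35 / 36) := by
  have hk : (k + 1 : ℝ≥0∞)⁻¹ * (k + 1 : ℝ≥0∞) = 1 :=
    ENNReal.inv_mul_cancel (by simp) (by finiteness)
  have hc2 : (2 ^ c : ℝ≥0∞)⁻¹ * (2 ^ c : ℝ≥0∞) = 1 :=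
    ENNReal.inv_mul_cancel (by simp) (by finiteness)
  have h22 : (2⁻¹ : ℝ≥0∞) * 2 = 1 := ENNReal.inv_mul_cancel (by simp) (by simp)
  have h2 := sum_dotProduct_ite hv 1 (ENNReal.ofReal (8 / 9))
  rw [sum_sampleLaw_mul]
  simp only [penalty, Finset.sum_const, Finset.card_univ, Fintype.card_fin, nsmul_eq_mul, mul_one]
  have e1 : (2 ^ c : ℝ≥0∞)⁻¹ *
      ∑ x : Bits c, (if x ⬝ᵥ v = x ⬝ᵥ r j then 1 else ENNReal.ofReal (8 / 9)) =
        2⁻¹ * (1 + ENNReal.ofReal (8 / 9)) := by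
    set a := ∑ x : Bits c, (if x ⬝ᵥ v = x ⬝ᵥ r j then 1 else ENNReal.ofReal (8 / 9))
    calc (2 ^ c : ℝ≥0∞)⁻¹ * a = (2 ^ c : ℝ≥0∞)⁻¹ * (2⁻¹ * 2 * a) := by rw [h22, one_mul]
      _ = (2 ^ c : ℝ≥0∞)⁻¹ * (2⁻¹ * (2 ^ c * (1 + ENNReal.ofReal (8 / 9)))) := by
          rw [mul_assoc 2⁻¹, h2]
      _ = (2 ^ c : ℝ≥0∞)⁻¹ * 2 ^ c * (2⁻¹ * (1 + ENNReal.ofReal (8 / 9))) := by ring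
      _ = _ := by rw [hc2, one_mul]
  push_cast
  rw [e1, hk]
  have h2r : (2⁻¹ : ℝ≥0∞) = ENNReal.ofReal 2⁻¹ := by
    rw [ENNReal.ofReal_inv_of_pos (by norm_num)]; simp
  rw [h2r, ← ENNReal.ofReal_one, ← ENNReal.ofReal_add (by norm_num) (by norm_num),
    ← ENNReal.ofReal_mul (by norm_num), ← ENNReal.ofReal_mul (by norm_num),
    ← ENNReal.ofReal_mul (by norm_num), ← ENNReal.ofReal_add (by norm_num) (by norm_num)]
  norm_num

/-- The exponential mechanism is likely to find `r j`. -/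
theorem one_le_sum_expMechanism (r : Bits d → Bits c) (s : Fin (k + 1) → Bits d) (j : Bits d) :
    1 ≤ (∑ x : Fin ℓ → Point c d (k + 1), (∏ i, sampleLaw r s (x i)) * expMechanism x j (r j)) +
      ENNReal.ofReal (2 ^ c * (35 / 36) ^ ℓ) := by
  have h1 : 1 ≤ ∑ x : Fin ℓ → Point c d (k + 1), (∏ i, sampleLaw r s (x i)) *
      (expMechanism x j (r j) + ∑ v' ∈ Finset.univ.erase (r j), weight x j v') := by
    rw [sum_prod_sampleLaw_mul]
    have hcard : (Fintype.card (Fin ℓ → Seed c k) : ℝ≥0∞)⁻¹ *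
        ∑ _u : Fin ℓ → Seed c k, 1 = 1 := by
      rw [Finset.sum_const, Finset.card_univ, nsmul_eq_mul, mul_one]
      exact ENNReal.inv_mul_cancel (by simp) (ENNReal.natCast_ne_top _)
    nth_rewrite 1 [← hcard]
    gcongr with u _
    refine one_le_expMechanism_add (Finset.prod_eq_one fun i _ => ?_)
    by_cases h : (u i).1 = true <;> simp [Seed.point, penalty, h]
  refine h1.trans ?_
  simp only [mul_add, Finset.sum_add_distrib]
  gcongr
  simp only [Finset.mul_sum]
  rw [Finset.sum_comm]
  have h2 : ∀ v ∈ Finset.univ.erase (r j), ∑ x : Fin ℓ → Point c d (k + 1),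
      (∏ i, sampleLaw r s (x i)) * weight x j v = ENNReal.ofReal (35 / 36) ^ ℓ := by
    intro v hv
    have := sum_prod_mul_prod (n := ℓ) (fun z => sampleLaw r s z) (fun _ => penalty j v) 1
    simp only [one_mul] at this
    simp only [weight]
    rw [this, sum_sampleLaw_mul_penalty r s j (Finset.ne_of_mem_erase hv), Finset.prod_const,
      Finset.card_univ, Fintype.card_fin]
  rw [Finset.sum_congr rfl h2, Finset.sum_const, nsmul_eq_mul, ENNReal.ofReal_mul (by positivity),
    ENNReal.ofReal_pow (by norm_num), ENNReal.ofReal_pow (by norm_num)]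
  gcongr
  simp

end ExponentialMechanism

/-! ### The agents' sign tables and the decoding of the shares -/

section SignTables

/-- The sign encoded by a bit. -/
def sgn (b : Bool) : ℝ := if b then 1 else -1

theorem sgn_not (b : Bool) : sgn (!b) = -sgn b := by cases b <;> simp [sgn]

theorem sgn_mul_self (b : Bool) : sgn b * sgn b = 1 := by cases b <;> simp [sgn]

theorem abs_sgn (b : Bool) : |sgn b| = 1 := by cases b <;> simp [sgn]

/-- Flipping the sign at `p` is an involution that negates each term. -/
theorem sum_sgn_mul {ι : Type*} [Fintype ι] [DecidableEq ι] (p : ι) (F : (ι → Bool) → ℝ)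
    (hF : ∀ g, F (Function.update g p (!g p)) = F g) : ∑ g, sgn (g p) * F g = 0 := by
  have hinv : Function.Involutive fun g : ι → Bool => Function.update g p (!g p) := by
    intro g; simp
  have h := Fintype.sum_equiv hinv.toPerm (fun g => sgn (g p) * F g)
    (fun g => -(sgn (g p) * F g)) fun g => by
      simp [Function.Involutive.coe_toPerm, hF, sgn_not]
  rw [Finset.sum_neg_distrib] at h
  linarith

theorem prod_one_add_sgn {n : ℕ} (u : Fin n → Bool) (l : ℝ) :
    ∏ i, (1 + l * sgn (u i)) =
      (1 + l) ^ (Finset.card {i | u i = true}) * (1 - l) ^ (n - Finset.card {i | u i = true}) := by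
  have h : ∀ i, 1 + l * sgn (u i) = if u i = true then 1 + l else 1 - l := by
    intro i
    by_cases hi : u i = true <;> simp [sgn, hi]
    ring
  simp only [h]
  rw [Finset.prod_ite, Finset.prod_const, Finset.prod_const]
  congr 2
  have := Finset.card_filter_add_card_filter_not (s := (Finset.univ : Finset (Fin n)))
    (p := fun i => u i = true)
  rw [Finset.card_univ, Fintype.card_fin] at this
  omega

variable {c d k : ℕ}

/-- A table of signs, one for each possible share. -/
abbrev Table (d k : ℕ) : Type := Fin (k + 1) × Bits d → Bool

/-- The density of the answer `g` of an agent with respect to the uniform distribution: the sign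
at the agent's share, if there is one, is slightly biased. -/
noncomputable def tableDensity (z : Point c d (k + 1)) (g : Table d k) : ℝ :=
  match z with
  | .inl _ => 1
  | .inr p => 1 + sgn (g p) / 9

theorem tableDensity_bounds (z : Point c d (k + 1)) (g : Table d k) :
    8 / 9 ≤ tableDensity z g ∧ tableDensity z g ≤ 10 / 9 := by
  rcases z with z | p
  · norm_num [tableDensity]
  · simp only [tableDensity]
    cases g p <;> norm_num [sgn]

theorem sum_sgn_eq_zero {ι : Type*} [Fintype ι] [DecidableEq ι] (p : ι) :
    ∑ g : ι → Bool, sgn (g p) = 0 := by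
  simpa using sum_sgn_mul p (fun _ => 1) fun _ => rfl

/-- The law of an agent's answer. -/
noncomputable def tableLaw (z : Point c d (k + 1)) : PMF (Table d k) :=
  PMF.ofFintype
    (fun g => ENNReal.ofReal ((Fintype.card (Table d k) : ℝ)⁻¹ * tableDensity z g)) <| by
    have hN : (Fintype.card (Table d k) : ℝ) ≠ 0 := by exact_mod_cast Fintype.card_ne_zero
    rw [← ENNReal.ofReal_sum_of_nonneg fun g _ => mul_nonneg (by positivity)
      (le_trans (by norm_num) (tableDensity_bounds z g).1), ← Finset.mul_sum]
    have : ∑ g, tableDensity z g = (Fintype.card (Table d k) : ℝ) := by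
      rcases z with z | p
      · simp [tableDensity]
      · simp only [tableDensity, Finset.sum_add_distrib, ← Finset.sum_div]
        rw [sum_sgn_eq_zero]
        simp
    rw [this, inv_mul_cancel₀ hN, ENNReal.ofReal_one]

theorem tableLaw_apply (z : Point c d (k + 1)) (g : Table d k) :
    tableLaw z g = ENNReal.ofReal ((Fintype.card (Table d k) : ℝ)⁻¹ * tableDensity z g) := rfl

/-- The bias `1 / 9` makes the extreme ratio of densities `10 / 8 = 1 + 1 / 4 ≤ exp (1 / 4)`. -/
theorem tableLaw_le (z z' : Point c d (k + 1)) (g : Table d k) :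
    tableLaw z g ≤ ENNReal.ofReal (Real.exp (1 / 4)) * tableLaw z' g := by
  rw [tableLaw_apply, tableLaw_apply, ← ENNReal.ofReal_mul (Real.exp_pos _).le]
  refine ENNReal.ofReal_le_ofReal ?_
  have h1 := tableDensity_bounds z g
  have h2 := tableDensity_bounds z' g
  have h3 := Real.add_one_le_exp (1 / 4)
  rw [mul_left_comm]
  gcongr
  nlinarith

/-- The law of an agent's answer over the choice of its input. -/
noncomputable def averageTable (s : Fin (k + 1) → Bits d) (g : Table d k) : ℝ :=
  (Fintype.card (Table d k) : ℝ)⁻¹ * (1 + (18 * (k + 1 : ℝ))⁻¹ * ∑ t, sgn (g (t, s t)))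

theorem averageTable_nonneg (s : Fin (k + 1) → Bits d) (g : Table d k) :
    0 ≤ averageTable s g := by
  refine mul_nonneg (by positivity) ?_
  have h1 : |∑ t, sgn (g (t, s t))| ≤ k + 1 := by
    refine (Finset.abs_sum_le_sum_abs _ _).trans ?_
    simp [abs_sgn]
  have h2 : (18 * (k + 1 : ℝ))⁻¹ * (k + 1) = 1 / 18 := by field_simp
  have h3 : (0 : ℝ) ≤ (18 * (k + 1 : ℝ))⁻¹ := by positivity
  nlinarith [(abs_le.1 h1).1]

/-- A given share is sampled with probability `1 / (2 * (k + 1))`; times the bias `1 / 9` this gives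
the constant `18 * (k + 1)`. The strings drop out. -/
theorem sum_sampleLaw_mul_tableLaw (r : Bits d → Bits c) (s : Fin (k + 1) → Bits d)
    (g : Table d k) :
    ∑ z, sampleLaw r s z * tableLaw z g = ENNReal.ofReal (averageTable s g) := by
  have h2r : (2⁻¹ : ℝ≥0∞) = ENNReal.ofReal 2⁻¹ := by
    rw [ENNReal.ofReal_inv_of_pos (by norm_num)]; simp
  have hcr : (2 ^ c : ℝ≥0∞)⁻¹ = ENNReal.ofReal (2 ^ c)⁻¹ := by
    rw [ENNReal.ofReal_inv_of_pos (by positivity), ENNReal.ofReal_pow (by norm_num)]; simp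
  have hkr : (k + 1 : ℝ≥0∞)⁻¹ = ENNReal.ofReal (k + 1 : ℝ)⁻¹ := by
    rw [ENNReal.ofReal_inv_of_pos (by positivity), ENNReal.ofReal_add (by positivity) (by norm_num)]
    simp
  have hnn : ∀ z : Point c d (k + 1),
      0 ≤ (Fintype.card (Table d k) : ℝ)⁻¹ * tableDensity z g := fun z =>
    mul_nonneg (by positivity) (le_trans (by norm_num) (tableDensity_bounds z g).1)
  have h1 : ∀ {ι : Type} (S : Finset ι) (f : ι → Point c d (k + 1)),
      0 ≤ ∑ x ∈ S, (Fintype.card (Table d k) : ℝ)⁻¹ * tableDensity (f x) g := fun S f =>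
    Finset.sum_nonneg fun x _ => hnn _
  simp only [sum_sampleLaw_mul, tableLaw_apply]
  rw [← ENNReal.ofReal_sum_of_nonneg fun _ _ => hnn _,
    ← ENNReal.ofReal_sum_of_nonneg fun _ _ => hnn _, h2r, hcr, hkr,
    ← ENNReal.ofReal_mul (by positivity), ← ENNReal.ofReal_mul (by positivity),
    ← ENNReal.ofReal_mul (by positivity), ← ENNReal.ofReal_mul (by positivity),
    ← ENNReal.ofReal_add (mul_nonneg (by positivity) (mul_nonneg (by positivity) (h1 _ _)))
      (mul_nonneg (by positivity) (mul_nonneg (by positivity) (h1 _ _)))]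
  congr 1
  have hk : (k + 1 : ℝ) ≠ 0 := by positivity
  have hc : (2 ^ c : ℝ) ≠ 0 := by positivity
  simp only [tableDensity, averageTable, ← Finset.mul_sum, Finset.sum_add_distrib,
    ← Finset.sum_div, Finset.sum_const, Finset.card_univ, nsmul_eq_mul, Fintype.card_fin]
  have hcard : (Fintype.card (Bits c) : ℝ) = 2 ^ c := by simp
  rw [hcard]
  generalize (Fintype.card (Table d k) : ℝ)⁻¹ = N
  push_cast
  field_simp
  ring

/-- Signs at different places are orthogonal. The place `(t, v)` does not occur in the density, so
its factor averages out; only the correlation of the sign at `(t, s t)` with itself survives. -/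
theorem sum_averageTable_mul {t : Fin (k + 1)} {s : Fin (k + 1) → Bits d} {v : Bits d}
    (hv : v ≠ s t) (l : ℝ) :
    ∑ g, averageTable s g * ((1 - l * sgn (g (t, s t))) * (1 + l * sgn (g (t, v)))) =
      1 - l * (18 * (k + 1 : ℝ))⁻¹ := by
  set μ := (18 * (k + 1 : ℝ))⁻¹
  have hN : (Fintype.card (Table d k) : ℝ) ≠ 0 := by exact_mod_cast Fintype.card_ne_zero
  let F : Table d k → ℝ := fun g => (1 + μ * ∑ t', sgn (g (t', s t'))) * (1 - l * sgn (g (t, s t)))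
  have hne : ∀ t', (t', s t') ≠ (t, v) := by
    rintro t' h
    obtain ⟨rfl, h2⟩ := Prod.mk.inj h
    exact hv h2.symm
  have e1 : ∑ g, sgn (g (t, v)) * F g = 0 := by
    refine sum_sgn_mul _ F fun g => ?_
    simp only [F, Function.update_of_ne (hne _)]
  have e2 : ∀ t', ∑ g : Table d k, sgn (g (t', s t')) * sgn (g (t, s t)) =
      if t' = t then (Fintype.card (Table d k) : ℝ) else 0 := by
    intro t'
    split_ifs with h
    · subst h
      simp only [sgn_mul_self, Finset.sum_const, Finset.card_univ, nsmul_eq_mul, mul_one]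
    · refine sum_sgn_mul _ (fun g => sgn (g (t, s t))) fun g => ?_
      rw [Function.update_of_ne]
      intro h'
      exact h (Prod.mk.inj h').1.symm
  have e3 : ∑ g, F g = Fintype.card (Table d k) * (1 - l * μ) := by
    have : ∀ g, F g = 1 + μ * ∑ t', sgn (g (t', s t')) - l * sgn (g (t, s t)) -
        l * μ * ∑ t', sgn (g (t', s t')) * sgn (g (t, s t)) := by
      intro g
      rw [← Finset.sum_mul]
      simp only [F]
      ring
    simp only [this, Finset.sum_sub_distrib, Finset.sum_add_distrib, ← Finset.mul_sum]
    have c1 : ∑ g : Table d k, ∑ t', sgn (g (t', s t')) = 0 := by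
      rw [Finset.sum_comm]; simp [sum_sgn_eq_zero]
    have c2 : ∑ g : Table d k, ∑ t', sgn (g (t', s t')) * sgn (g (t, s t)) =
        Fintype.card (Table d k) := by
      rw [Finset.sum_comm]; simp only [e2]; simp
    rw [c1, c2, sum_sgn_eq_zero, Finset.sum_const, Finset.card_univ, nsmul_eq_mul]
    ring
  have e4 : ∀ g, averageTable s g * ((1 - l * sgn (g (t, s t))) * (1 + l * sgn (g (t, v)))) =
      (Fintype.card (Table d k) : ℝ)⁻¹ * (F g + l * (sgn (g (t, v)) * F g)) := by
    intro g
    simp only [averageTable, F, μ]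
    ring
  simp only [e4, ← Finset.mul_sum, Finset.sum_add_distrib]
  rw [e1, e3, mul_zero, add_zero, inv_mul_cancel_left₀ hN]

/-- The number of agents whose answer has a positive sign at `p`. -/
def score {n : ℕ} (G : Fin n → Table d k) (p : Fin (k + 1) × Bits d) : ℕ :=
  Finset.card {i | G i p = true}

theorem score_le {n : ℕ} (G : Fin n → Table d k) (p : Fin (k + 1) × Bits d) : score G p ≤ n :=
  (Finset.card_le_univ _).trans (by simp)

/-- The exponents of `1 - l` and `1 + l` add up to `2 * n`. If `b` scores at least as high as `a`,
the larger base has at least half of them. This is the test function of the Chernoff bound. -/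
theorem pow_le_prod_of_score_le {n : ℕ} (G : Fin n → Table d k) {a b : Fin (k + 1) × Bits d}
    (h : score G a ≤ score G b) {l : ℝ} (h0 : 0 ≤ l) (h1 : l ≤ 1) :
    (1 - l ^ 2) ^ n ≤ ∏ i, (1 - l * sgn (G i a)) * (1 + l * sgn (G i b)) := by
  have e := prod_one_add_sgn (fun i => G i b) l
  have e' := prod_one_add_sgn (fun i => G i a) (-l)
  simp only [neg_mul, ← sub_eq_add_neg, sub_neg_eq_add] at e'
  rw [Finset.prod_mul_distrib, e, e']
  change _ ≤ (1 - l) ^ score G a * (1 + l) ^ (n - score G a) *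
    ((1 + l) ^ score G b * (1 - l) ^ (n - score G b))
  have hb := score_le G b
  obtain ⟨q, hq⟩ := Nat.exists_eq_add_of_le h
  obtain ⟨p, hp⟩ := Nat.exists_eq_add_of_le hb
  have e1 : n - score G b = p := by omega
  have e2 : n - score G a = q + p := by omega
  have e3 : n = score G a + q + p := by omega
  rw [e1, e2, hq]
  have hl : 0 ≤ 1 - l := by linarith
  have e4 : (1 - l ^ 2) ^ n = (1 - l) ^ score G a * (1 + l) ^ score G a * ((1 - l) ^ q *
      (1 + l) ^ q) * ((1 - l) ^ p * (1 + l) ^ p) := by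
    have : 1 - l ^ 2 = (1 - l) * (1 + l) := by ring
    rw [this, ← mul_pow, ← mul_pow, ← mul_pow, ← pow_add, ← pow_add, ← e3]
  rw [e4]
  calc _ ≤ (1 - l) ^ score G a * (1 + l) ^ score G a * ((1 + l) ^ q *
      (1 + l) ^ q) * ((1 - l) ^ p * (1 + l) ^ p) := by
        gcongr
        linarith
    _ = _ := by rw [pow_add, pow_add]; ring

theorem sum_averageTable (s : Fin (k + 1) → Bits d) : ∑ g, averageTable s g = 1 := by
  have hN : (Fintype.card (Table d k) : ℝ) ≠ 0 := by exact_mod_cast Fintype.card_ne_zero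
  simp only [averageTable, ← Finset.mul_sum, Finset.sum_add_distrib]
  rw [Finset.sum_comm]
  simp only [sum_sgn_eq_zero]
  rw [Finset.sum_const_zero, mul_zero, add_zero, Finset.sum_const, Finset.card_univ,
    nsmul_eq_mul, mul_one, inv_mul_cancel₀ hN]

/-- A wrong share is unlikely to beat the right one. -/
theorem sum_averageTable_score_le {n : ℕ} {t : Fin (k + 1)} {s : Fin (k + 1) → Bits d}
    {v : Bits d} (hv : v ≠ s t) :
    (∑ G : Fin n → Table d k, if score G (t, s t) ≤ score G (t, v) then
      ∏ i, averageTable s (G i) else 0) ≤ (1 - (36 * (k + 1 : ℝ))⁻¹ ^ 2) ^ n := by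
  -- Half the bias `2 * l` of the average table: the test function then has mean `1 - 2 * l ^ 2 ≤ (1
  -- - l ^ 2) ^ 2` per agent, against the lower bound `1 - l ^ 2`.
  set l := (36 * (k + 1 : ℝ))⁻¹ with hl
  have hk : (1 : ℝ) ≤ k + 1 := by linarith [Nat.cast_nonneg (α := ℝ) k]
  have h0 : 0 ≤ l := by positivity
  have h1 : l ≤ 1 / 36 := by
    rw [hl, inv_le_comm₀ (by positivity) (by norm_num)]; norm_num
  have hpos : 0 < 1 - l ^ 2 := by nlinarith
  have hμ : (18 * (k + 1 : ℝ))⁻¹ = 2 * l := by rw [hl]; field_simp; norm_num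
  have key : (1 - l ^ 2) ^ n * (∑ G : Fin n → Table d k,
      if score G (t, s t) ≤ score G (t, v) then ∏ i, averageTable s (G i) else 0) ≤
        (1 - 2 * l ^ 2) ^ n := by
    calc _ ≤ ∑ G : Fin n → Table d k, ∏ i, averageTable s (G i) *
          ((1 - l * sgn (G i (t, s t))) * (1 + l * sgn (G i (t, v)))) := by
          rw [Finset.mul_sum]
          refine Finset.sum_le_sum fun G _ => ?_
          rw [Finset.prod_mul_distrib]
          have hq : 0 ≤ ∏ i, averageTable s (G i) :=
            Finset.prod_nonneg fun i _ => averageTable_nonneg s _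
          split_ifs with h
          · rw [mul_comm]
            gcongr
            exact pow_le_prod_of_score_le G h h0 (by linarith)
          · rw [mul_zero]
            refine mul_nonneg hq (Finset.prod_nonneg fun i _ => ?_)
            have ha := abs_le.1 (abs_sgn (G i (t, s t))).le
            have hb := abs_le.1 (abs_sgn (G i (t, v))).le
            exact mul_nonneg (by nlinarith) (by nlinarith)
      _ = (∑ g, averageTable s g *
          ((1 - l * sgn (g (t, s t))) * (1 + l * sgn (g (t, v))))) ^ n := by
          rw [← Fintype.piFinset_univ, ← Finset.prod_univ_sum (fun _ => Finset.univ)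
            fun (_ : Fin n) g => averageTable s g *
              ((1 - l * sgn (g (t, s t))) * (1 + l * sgn (g (t, v))))]
          simp
      _ = _ := by rw [sum_averageTable_mul hv, hμ]; ring
  have h2 : (1 - 2 * l ^ 2) ^ n ≤ (1 - l ^ 2) ^ n * (1 - l ^ 2) ^ n := by
    rw [← mul_pow]
    refine pow_le_pow_left₀ (by nlinarith) ?_ n
    nlinarith [sq_nonneg (l ^ 2)]
  exact le_of_mul_le_mul_left (key.trans h2) (by positivity)

/-- The share with the highest score. -/
noncomputable def decode {n : ℕ} (G : Fin n → Table d k) (t : Fin (k + 1)) : Bits d :=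
  (Finite.exists_max fun v => score G (t, v)).choose

theorem decode_eq {n : ℕ} {G : Fin n → Table d k} {s : Fin (k + 1) → Bits d}
    (h : ∀ t v, v ≠ s t → score G (t, v) < score G (t, s t)) : decode G = s := by
  funext t
  by_contra hne
  exact (h t _ hne).not_ge ((Finite.exists_max fun v => score G (t, v)).choose_spec (s t))

-- A union bound over all share positions and all wrong values.
open Classical in
theorem one_le_sum_decode {n : ℕ} (s : Fin (k + 1) → Bits d) :
    1 ≤ (∑ G : Fin n → Table d k, if decode G = s then ∏ i, averageTable s (G i) else 0) +
      (k + 1) * 2 ^ d * (1 - (36 * (k + 1 : ℝ))⁻¹ ^ 2) ^ n := by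
  have hnn : ∀ G : Fin n → Table d k, 0 ≤ ∏ i, averageTable s (G i) := fun G =>
    Finset.prod_nonneg fun i _ => averageTable_nonneg s _
  have h1 : (1 : ℝ) = ∑ G : Fin n → Table d k, ∏ i, averageTable s (G i) := by
    rw [← Fintype.piFinset_univ, ← Finset.prod_univ_sum (fun _ => Finset.univ)
      fun (_ : Fin n) g => averageTable s g]
    simp [sum_averageTable]
  have h2 : ∀ G : Fin n → Table d k, ∏ i, averageTable s (G i) ≤
      (if decode G = s then ∏ i, averageTable s (G i) else 0) +
        ∑ t, ∑ v ∈ Finset.univ.erase (s t),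
          if score G (t, s t) ≤ score G (t, v) then ∏ i, averageTable s (G i) else 0 := by
    intro G
    have hterm : ∀ t v, 0 ≤
        if score G (t, s t) ≤ score G (t, v) then ∏ i, averageTable s (G i) else 0 := by
      intro t v
      split_ifs
      · exact hnn G
      · exact le_rfl
    by_cases hG : decode G = s
    · rw [if_pos hG]
      exact le_add_of_nonneg_right
        (Finset.sum_nonneg fun t _ => Finset.sum_nonneg fun v _ => hterm t v)
    · rw [if_neg hG, zero_add]
      obtain ⟨t, v, hv, hle⟩ : ∃ t v, v ≠ s t ∧ score G (t, s t) ≤ score G (t, v) := by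
        by_contra! hcon
        exact hG (decode_eq hcon)
      refine le_trans ?_ (Finset.single_le_sum
        (fun t _ => Finset.sum_nonneg fun v _ => hterm t v) (Finset.mem_univ t))
      refine le_trans ?_ (Finset.single_le_sum (fun v _ => hterm t v)
        (Finset.mem_erase.2 ⟨hv, Finset.mem_univ v⟩))
      rw [if_pos hle]
  calc (1 : ℝ) = ∑ G : Fin n → Table d k, ∏ i, averageTable s (G i) := h1
    _ ≤ _ := Finset.sum_le_sum fun G _ => h2 G
    _ = (∑ G : Fin n → Table d k, if decode G = s then ∏ i, averageTable s (G i) else 0) +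
        ∑ t, ∑ v ∈ Finset.univ.erase (s t), ∑ G : Fin n → Table d k,
          if score G (t, s t) ≤ score G (t, v) then ∏ i, averageTable s (G i) else 0 := by
        rw [Finset.sum_add_distrib, Finset.sum_comm]
        congr 1
        exact Finset.sum_congr rfl fun t _ => Finset.sum_comm
    _ ≤ (∑ G : Fin n → Table d k, if decode G = s then ∏ i, averageTable s (G i) else 0) +
        ∑ t : Fin (k + 1), ∑ _v ∈ Finset.univ.erase (s t),
          (1 - (36 * (k + 1 : ℝ))⁻¹ ^ 2) ^ n := by
        gcongr with t _ v hv
        exact sum_averageTable_score_le (Finset.ne_of_mem_erase hv)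
    _ ≤ _ := by
        have hk : (1 : ℝ) ≤ k + 1 := by linarith [Nat.cast_nonneg (α := ℝ) k]
        have h3 : (36 * (k + 1 : ℝ))⁻¹ ≤ 1 := inv_le_one_of_one_le₀ (by linarith)
        have h4 : 0 ≤ (36 * (k + 1 : ℝ))⁻¹ := by positivity
        have hp : 0 ≤ (1 - (36 * (k + 1 : ℝ))⁻¹ ^ 2) ^ n := pow_nonneg (by nlinarith) _
        gcongr
        simp only [Finset.sum_const, nsmul_eq_mul, Finset.card_univ, Fintype.card_fin,
          Finset.card_erase_of_mem (Finset.mem_univ _)]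
        push_cast
        rw [← mul_assoc]
        gcongr
        have hcard : Fintype.card (Bits d) = 2 ^ d := by simp
        rw [hcard]
        exact_mod_cast Nat.sub_le _ _

end SignTables

/-! ### The hybrid protocol -/

section HybridProtocol

/-- The messages of the hybrid protocol: sign tables, queried indices, and strings. -/
abbrev HybridMsg (c d k : ℕ) : Type := Table d k ⊕ (Bits d ⊕ Bits c)

/-- The curator runs the exponential mechanism for the string with the index it was sent last. -/
noncomputable def hybridCurator (c d m : ℕ) : Party (Point c d (m + 1)) m (HybridMsg c d m) :=
  Party.ofKernel (fun x j => expMechanism x j)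
    (fun h => match h.getLast? with
      | some (.inr (.inl j)) => j
      | _ => 0) fun v => .inr (.inr v)

/-- The agents answer with noisy sign tables. -/
noncomputable def hybridAgent (c d m : ℕ) : Party (Point c d (m + 1)) 1 (HybridMsg c d m) :=
  Party.ofKernel (fun y (_ : Unit) => tableLaw (y 0)) (fun _ => ()) .inl

theorem hybridCurator_isPrivate (c d m : ℕ) : (hybridCurator c d m).IsPrivate 1 (1 / 4) :=
  Party.ofKernel_isPrivate_one (fun _ _ h j v => expMechanism_le h j v) _ _

theorem hybridAgent_isPrivate (c d m : ℕ) : (hybridAgent c d m).IsPrivate 1 (1 / 4) :=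
  Party.ofKernel_isPrivate_one (fun _ _ _ _ g => tableLaw_le _ _ g) _ _

theorem hybridCurator_law {c d m : ℕ} (x : Fin m → Point c d (m + 1)) (j : Bits d) (v : Bits c) :
    (hybridCurator c d m).law
        {ω | (hybridCurator c d m).reply x ω [.inr (.inl j)] = .inr (.inr v)} =
      expMechanism x j v :=
  Party.ofKernel_law_apply (fun x j => expMechanism x j) _
    (fun _ _ h => Sum.inr_injective (Sum.inr_injective h)) x [.inr (.inl j)] v

theorem hybridAgent_law {c d m : ℕ} (z : Point c d (m + 1)) (h : List (HybridMsg c d m))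
    (g : Table d m) :
    (hybridAgent c d m).law {ω | (hybridAgent c d m).reply (fun _ => z) ω h = .inl g} =
      tableLaw z g :=
  Party.ofKernel_law_apply (fun y (_ : Unit) => tableLaw (y 0)) (fun _ => ()) Sum.inl_injective
    (fun _ => z) h g

/-- The agents send noisy sign tables from which the referee decodes the shares; then
the curator runs the exponential mechanism for the string with the decoded index. -/
noncomputable def hybridProtocol (c d m n : ℕ) :
    Protocol (Point c d (m + 1)) (Bits c) [.agents, .curator] m n where
  Msg := HybridMsg c d m
  curator := hybridCurator c d m
  agent _ := hybridAgent c d m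
  RefCoins := Unit
  refLaw := Measure.dirac ()
  toCurator _ view := match view.head? with
    | some (.inr b) =>
      -- The constant table stands in for messages that are not tables; honest agents never send
      -- such messages.
      .inr (.inl (∑ t, decode (fun i => (b i).elim id fun _ _ => false) t))
    | _ => .inr (.inl 0)
  toAgent _ _ _ := .inr (.inl 0)
  output _ view := match view.getLast? with
    | some (.inl (.inr (.inr v))) => v
    | _ => 0
  measurableSet_toCurator _ _ := MeasurableSet.of_discrete
  measurableSet_toAgent _ _ _ := MeasurableSet.of_discrete
  measurableSet_output _ _ := MeasurableSet.of_discrete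

variable {c d m n : ℕ}

theorem hybridProtocol_isPrivate : (hybridProtocol c d m n).IsPrivate (1 / 4) :=
  ⟨hybridCurator_isPrivate c d m, fun _ => hybridAgent_isPrivate c d m⟩

theorem hybridProtocol_agentsIgnoreMessages :
    (hybridProtocol c d m n).AgentsIgnoreMessages := fun _ _ _ _ _ _ => rfl

-- Correct decoding and the answer `v` to the query for the true index involve coins of different
-- parties; this product event is contained in the event that `v` is output.
open Classical in
theorem le_outputProb_hybridProtocol (x : Fin m → Point c d (m + 1))
    (y : Fin n → Point c d (m + 1)) (s : Fin (m + 1) → Bits d) (v : Bits c) :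
    expMechanism x (∑ t, s t) v *
        (∑ G : Fin n → Table d m, if decode G = s then ∏ i, tableLaw (y i) (G i) else 0) ≤
      (hybridProtocol c d m n).outputProb x y v := by
  let P := hybridProtocol c d m n
  let q₀ : HybridMsg c d m := .inr (.inl 0)
  let e : Table d m → HybridMsg c d m := .inl
  let A : Set (hybridCurator c d m).Coins :=
    {ω | (hybridCurator c d m).reply x ω [.inr (.inl (∑ t, s t))] = .inr (.inr v)}
  let B : (Fin n → Table d m) → Set (Fin n → (hybridAgent c d m).Coins) := fun G =>
    Set.univ.pi fun i => {ω | (hybridAgent c d m).reply (fun _ => y i) ω [q₀] = e (G i)}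
  let S : Finset (Fin n → Table d m) := {G | decode G = s}
  have hBU : (Measure.pi fun _ => (hybridAgent c d m).law) (⋃ G ∈ S, B G) =
      ∑ G : Fin n → Table d m, if decode G = s then ∏ i, tableLaw (y i) (G i) else 0 := by
    rw [measure_biUnion_finset]
    · simp only [B, Measure.pi_pi, e, hybridAgent_law, S, Finset.sum_filter]
    · intro G _ G' _ hne
      rw [Function.onFun, Set.disjoint_left]
      intro ω h h'
      refine hne (funext fun i => Sum.inl_injective (β := Bits d ⊕ Bits c) ?_)
      exact (h i trivial).symm.trans (h' i trivial)
    · exact fun G _ => MeasurableSet.univ_pi fun i =>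
        (hybridAgent c d m).measurableSet_reply _ _ _
  have hsub : Set.univ ×ˢ (A ×ˢ ⋃ G ∈ S, B G) ⊆ {ω : P.Coins | P.result x y ω = v} := by
    rintro ⟨ρ, ωc, ωa⟩ ⟨-, hωA, hωB⟩
    obtain ⟨G, hG, hωG⟩ := Set.mem_iUnion₂.1 hωB
    have hG' : decode G = s := by simpa [S] using hG
    have h1 : (fun i => (hybridAgent c d m).reply (fun _ => y i) (ωa i) [q₀]) =
        fun i => e (G i) := funext fun i => hωG i trivial
    have h2 : P.toCurator ρ [.inr fun i => e (G i)] =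
        (.inr (.inl (∑ t, s t)) : HybridMsg c d m) := by
      change (.inr (.inl (∑ t, decode G t)) : HybridMsg c d m) = .inr (.inl (∑ t, s t))
      rw [hG']
    change P.output ρ [.inr fun i => (hybridAgent c d m).reply (fun _ => y i) (ωa i) [q₀],
      .inl ((hybridCurator c d m).reply x ωc [P.toCurator ρ
        [.inr fun i => (hybridAgent c d m).reply (fun _ => y i) (ωa i) [q₀]]])] = v
    rw [h1, h2, show (hybridCurator c d m).reply x ωc _ = _ from hωA]
    rfl
  calc _ = P.coinLaw (Set.univ ×ˢ (A ×ˢ ⋃ G ∈ S, B G)) := by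
        change _ = (P.refLaw.prod ((hybridCurator c d m).law.prod
          (Measure.pi fun _ => (hybridAgent c d m).law))) _
        rw [Measure.prod_prod, Measure.prod_prod, hybridCurator_law, hBU, measure_univ, one_mul]
    _ ≤ _ := measure_mono hsub

/-- The hybrid protocol solves the task if there are sufficiently many samples. -/
theorem hybridProtocol_solves (h1 : (2 : ℝ) ^ c * (35 / 36) ^ m ≤ 1 / 8)
    (h2 : (m + 1) * 2 ^ d * (1 - (36 * (m + 1 : ℝ))⁻¹ ^ 2) ^ n ≤ 1 / 8) :
    SolvesOneOutOfParity (hybridProtocol c d m n) (1 / 4) := by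
  classical
  intro r s
  have e18 : ENNReal.ofReal (7 / 8) + ENNReal.ofReal (1 / 8) = 1 := by
    rw [← ENNReal.ofReal_add (by norm_num) (by norm_num)]; norm_num
  have hC : ENNReal.ofReal (7 / 8) ≤ ∑ x : Fin m → Point c d (m + 1),
      (∏ i, sampleLaw r s (x i)) * expMechanism x (∑ t, s t) (r (∑ t, s t)) := by
    have := (one_le_sum_expMechanism (ℓ := m) r s (∑ t, s t)).trans
      (add_le_add le_rfl (ENNReal.ofReal_le_ofReal h1))
    rw [← e18] at this
    exact (ENNReal.add_le_add_iff_right ENNReal.ofReal_ne_top).1 this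
  have hD : ENNReal.ofReal (7 / 8) ≤ ∑ y : Fin n → Point c d (m + 1),
      (∏ i, sampleLaw r s (y i)) *
        ∑ G : Fin n → Table d m, if decode G = s then ∏ i, tableLaw (y i) (G i) else 0 := by
    have e1 : ∑ y : Fin n → Point c d (m + 1), (∏ i, sampleLaw r s (y i)) *
        (∑ G : Fin n → Table d m, if decode G = s then ∏ i, tableLaw (y i) (G i) else 0) =
        ∑ G : Fin n → Table d m, if decode G = s then
          ENNReal.ofReal (∏ i, averageTable s (G i)) else 0 := by
      simp only [Finset.mul_sum]
      rw [Finset.sum_comm]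
      refine Finset.sum_congr rfl fun G _ => ?_
      split_ifs
      · have := sum_prod_mul_prod (n := n) (fun z => sampleLaw r s z)
          (fun i z => tableLaw z (G i)) 1
        simp only [one_mul, sum_sampleLaw_mul_tableLaw] at this
        rw [this, ENNReal.ofReal_prod_of_nonneg fun i _ => averageTable_nonneg s _]
      · simp
    have e2 : ∑ G : Fin n → Table d m, (if decode G = s then
          ENNReal.ofReal (∏ i, averageTable s (G i)) else 0) =
        ENNReal.ofReal (∑ G : Fin n → Table d m, if decode G = s then
          ∏ i, averageTable s (G i) else 0) := by
      rw [ENNReal.ofReal_sum_of_nonneg]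
      · refine Finset.sum_congr rfl fun G _ => ?_
        split_ifs <;> simp
      · intro G _
        split_ifs
        · exact Finset.prod_nonneg fun i _ => averageTable_nonneg s _
        · exact le_rfl
    rw [e1, e2]
    refine ENNReal.ofReal_le_ofReal ?_
    linarith [one_le_sum_decode (n := n) s]
  -- Each phase fails with probability at most `1 / 8`, and `(7 / 8) ^ 2 = 49 / 64 ≥ 3 / 4`.
  calc ENNReal.ofReal (1 - 1 / 4) ≤ ENNReal.ofReal (7 / 8) * ENNReal.ofReal (7 / 8) := by
        rw [← ENNReal.ofReal_mul (by norm_num)]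
        exact ENNReal.ofReal_le_ofReal (by norm_num)
    _ ≤ _ := mul_le_mul' hC hD
    _ = ∑ x : Fin m → Point c d (m + 1), ∑ y : Fin n → Point c d (m + 1),
          (∏ i, sampleLaw r s (x i)) * (∏ i, sampleLaw r s (y i)) *
            (expMechanism x (∑ t, s t) (r (∑ t, s t)) *
              ∑ G : Fin n → Table d m, if decode G = s then ∏ i, tableLaw (y i) (G i) else 0) := by
        rw [Finset.sum_mul_sum]
        exact Finset.sum_congr rfl fun x _ => Finset.sum_congr rfl fun y _ => by ring
    _ ≤ _ := by
        gcongr with x _ y _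
        exact le_outputProb_hybridProtocol x y s _

end HybridProtocol

/-! ### Choice of the parameters -/

section Parameters

/-- The binary length of `c`. -/
def binaryLength (c : ℕ) : ℕ := Nat.log 2 c + 1

theorem lt_two_pow_binaryLength (c : ℕ) : c < 2 ^ binaryLength c :=
  Nat.lt_pow_succ_log_self (by norm_num) c

theorem binaryLength_pos (c : ℕ) : 1 ≤ binaryLength c := Nat.le_add_left 1 _

theorem two_pow_mul_pow_le {c : ℕ} (hc : 1 ≤ c) :
    (2 : ℝ) ^ c * (35 / 36) ^ (127 * c) ≤ 1 / 8 := by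
  rw [pow_mul, ← mul_pow]
  have h : (2 : ℝ) * (35 / 36) ^ 127 ≤ 1 / 8 := by norm_num
  refine (pow_le_pow_left₀ (by positivity) h c).trans ?_
  exact pow_le_of_le_one (by norm_num) (by norm_num) (by omega)

/-- Since `m + 1 ≤ 128 * c` and `64 * (36 * 128) ^ 2 ≤ 2 ^ 31`, each block of `2 ^ 31 * c ^ 2`
agents contributes at most `2 ^ (-64)`. The `L` blocks beat the union bound, which is at most `2 ^
(4 * L + 43)`. -/
theorem decoding_error_le {c : ℕ} (hc : 1 ≤ c) :
    (((127 * c : ℕ) : ℝ) + 1) * 2 ^ (3 * binaryLength c + 36) *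
      (1 - (36 * (((127 * c : ℕ) : ℝ) + 1))⁻¹ ^ 2) ^ (2 ^ 31 * c ^ 2 * binaryLength c) ≤ 1 / 8 := by
  set L := binaryLength c
  have hL : 1 ≤ L := binaryLength_pos c
  have hc' : (1 : ℝ) ≤ c := by exact_mod_cast hc
  set M : ℝ := ((127 * c : ℕ) : ℝ) + 1 with hM
  have hM1 : 1 ≤ M := by rw [hM]; push_cast; linarith
  have hM2 : M ≤ 128 * c := by rw [hM]; push_cast; linarith
  have hcL : (c : ℝ) ≤ 2 ^ L := by exact_mod_cast (lt_two_pow_binaryLength c).le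
  have h0 : 0 ≤ 1 - (36 * M)⁻¹ ^ 2 := by
    have : (36 * M)⁻¹ ≤ 1 := inv_le_one_of_one_le₀ (by linarith)
    have : 0 ≤ (36 * M)⁻¹ := by positivity
    nlinarith
  have hstep : (1 - (36 * M)⁻¹ ^ 2) ^ (2 ^ 31 * c ^ 2) ≤ (1 / 2) ^ 64 := by
    have h1 : 1 - (36 * M)⁻¹ ^ 2 ≤ Real.exp (-(36 * M)⁻¹ ^ 2) := by
      linarith [Real.add_one_le_exp (-(36 * M)⁻¹ ^ 2)]
    have h2 : (64 : ℝ) ≤ ((2 ^ 31 * c ^ 2 : ℕ) : ℝ) * (36 * M)⁻¹ ^ 2 := by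
      rw [inv_pow, ← div_eq_mul_inv, le_div_iff₀ (by positivity)]
      push_cast
      have : M ^ 2 ≤ (128 * c) ^ 2 := by gcongr
      nlinarith
    calc (1 - (36 * M)⁻¹ ^ 2) ^ (2 ^ 31 * c ^ 2)
        ≤ Real.exp (-(36 * M)⁻¹ ^ 2) ^ (2 ^ 31 * c ^ 2) := pow_le_pow_left₀ h0 h1 _
      _ = Real.exp (((2 ^ 31 * c ^ 2 : ℕ) : ℝ) * -(36 * M)⁻¹ ^ 2) := (Real.exp_nat_mul _ _).symm
      _ ≤ Real.exp ((64 : ℕ) * (-1)) := by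
          refine Real.exp_le_exp.2 ?_
          rw [mul_neg]
          push_cast at h2 ⊢
          linarith
      _ = Real.exp (-1) ^ 64 := Real.exp_nat_mul _ _
      _ ≤ (1 / 2) ^ 64 := by
          gcongr
          rw [Real.exp_neg, one_div]
          gcongr
          linarith [Real.add_one_le_exp 1]
  have hpow : (2 : ℝ) ^ (4 * L + 46) ≤ 2 ^ (64 * L) :=
    pow_le_pow_right₀ (by norm_num) (by omega)
  calc M * 2 ^ (3 * L + 36) * (1 - (36 * M)⁻¹ ^ 2) ^ (2 ^ 31 * c ^ 2 * L)
      ≤ (128 * 2 ^ L) * 2 ^ (3 * L + 36) * ((1 / 2) ^ 64) ^ L := by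
        rw [pow_mul (1 - (36 * M)⁻¹ ^ 2)]
        gcongr
        linarith
    _ = (2 ^ (4 * L + 46) / 2 ^ (64 * L)) * (1 / 8) := by
        rw [← pow_mul, one_div_pow]
        have : (2 : ℝ) ^ (4 * L + 46) = 2 ^ L * 2 ^ (3 * L + 36) * 2 ^ 10 := by
          rw [← pow_add, ← pow_add]; congr 1; ring
        rw [this]
        ring
    _ ≤ 1 * (1 / 8) := by
        gcongr
        rw [div_le_one (by positivity)]
        exact hpow
    _ = 1 / 8 := one_mul _

/-- Both `c` and `L` are at most `2 ^ L`, so `c ^ 2 * L ≤ 2 ^ (3 * L)`; this dictates the term `3 *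
L` in `d`, and `36` absorbs the constants. -/
theorem samples_le_two_pow {c : ℕ} (hc : 1 ≤ c) :
    16 * (127 * c + 2 ^ 31 * c ^ 2 * binaryLength c) + 128 ≤ 2 ^ (3 * binaryLength c + 36) := by
  set L := binaryLength c
  have hL : 1 ≤ L := binaryLength_pos c
  have h1 : c ^ 2 * L ≤ (2 ^ L) ^ 2 * 2 ^ L :=
    Nat.mul_le_mul (Nat.pow_le_pow_left (lt_two_pow_binaryLength c).le 2) Nat.lt_two_pow_self.le
  have h2 : 2 ^ (3 * L + 36) = 2 ^ 36 * ((2 ^ L) ^ 2 * 2 ^ L) := by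
    rw [← pow_mul, ← pow_add, ← pow_add]; congr 1; ring
  have h3 : c ≤ c ^ 2 * L := by nlinarith
  rw [h2]
  have h4 : 2 ^ 31 * c ^ 2 * L = 2 ^ 31 * (c ^ 2 * L) := by ring
  rw [h4]
  generalize c ^ 2 * L = w at *
  generalize (2 ^ L) ^ 2 * 2 ^ L = w' at *
  omega

theorem log_le_binaryLength {c : ℕ} (hc : 2 ≤ c) : Real.log c ≤ binaryLength c := by
  have h : (c : ℝ) ≤ 2 ^ binaryLength c := by exact_mod_cast (lt_two_pow_binaryLength c).le
  have h1 := Real.log_le_log (by positivity) h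
  rw [Real.log_pow] at h1
  have h2 := Real.log_two_lt_d9
  have h3 : (0 : ℝ) ≤ binaryLength c := Nat.cast_nonneg _
  nlinarith

theorem binaryLength_le_log {c : ℕ} (hc : 2 ≤ c) : (binaryLength c : ℝ) ≤ 4 * Real.log c := by
  have h : ((2 ^ Nat.log 2 c : ℕ) : ℝ) ≤ c := by
    exact_mod_cast Nat.pow_log_le_self 2 (by omega)
  have h1 := Real.log_le_log (by positivity) h
  rw [Nat.cast_pow, Nat.cast_ofNat, Real.log_pow] at h1
  have h2 := Real.log_two_gt_d9
  have h3 : (1 : ℝ) ≤ Nat.log 2 c := by exact_mod_cast Nat.log_pos (by norm_num) hc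
  simp only [binaryLength]
  push_cast
  nlinarith

theorem isTheta_principal_Ici_two {f g : ℕ → ℝ} (a b : ℝ) (hf : ∀ c, 0 ≤ f c)
    (h1 : ∀ c, 2 ≤ c → f c ≤ a * g c) (h2 : ∀ c, 2 ≤ c → g c ≤ b * f c)
    (hg : ∀ c, 2 ≤ c → 0 ≤ g c) : f =Θ[𝓟 (Set.Ici 2)] g := by
  constructor
  · refine IsBigO.of_bound a (eventually_principal.2 fun c hc => ?_)
    rw [Real.norm_of_nonneg (hf c), Real.norm_of_nonneg (hg c hc)]
    exact h1 c hc
  · refine IsBigO.of_bound b (eventually_principal.2 fun c hc => ?_)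
    rw [Real.norm_of_nonneg (hf c), Real.norm_of_nonneg (hg c hc)]
    exact h2 c hc

/-- The left side is of order at most `c ^ 6`, with constant below `2 ^ 70`. -/
theorem eventually_agents_le_two_pow :
    ∀ᶠ c : ℕ in atTop, 16 * (2 ^ 31 * c ^ 2 * binaryLength c + 1) ^ 2 ≤ 2 ^ c := by
  have h := tendsto_pow_const_div_const_pow_of_one_lt 6 (r := (2 : ℝ)) (by norm_num)
  have h' := h.eventually (gt_mem_nhds (show (0 : ℝ) < 1 / 2 ^ 70 by positivity))
  filter_upwards [h', eventually_ge_atTop 1] with c hc hc1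
  have hL : binaryLength c ≤ 2 * c := by
    have := Nat.log_lt_self 2 (x := c) (by omega)
    simp only [binaryLength]
    omega
  rw [div_lt_div_iff₀ (by positivity) (by positivity)] at hc
  have hc2 : c ^ 6 * 2 ^ 70 < 1 * 2 ^ c := by exact_mod_cast hc
  have h3 : 1 ≤ c ^ 3 := Nat.one_le_pow _ _ hc1
  calc 16 * (2 ^ 31 * c ^ 2 * binaryLength c + 1) ^ 2
      ≤ 16 * (2 ^ 31 * c ^ 2 * (2 * c) + c ^ 3) ^ 2 := by gcongr
    _ = (16 * (2 ^ 32 + 1) ^ 2) * c ^ 6 := by ring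
    _ ≤ 2 ^ 70 * c ^ 6 := by gcongr; norm_num
    _ ≤ 2 ^ c := by omega

end Parameters

end HybridDP

/-! ### The theorem -/

theorem mainTheorem2 :
    ∃ d m n : ℕ → ℕ,
      (fun c : ℕ => (d c : ℝ)) =Θ[𝓟 (Set.Ici 2)] (fun c : ℕ => Real.log c) ∧
      (fun c : ℕ => (m c : ℝ)) =Θ[𝓟 (Set.Ici 2)] (fun c : ℕ => (c : ℝ)) ∧
      (fun c : ℕ => (n c : ℝ)) =Θ[𝓟 (Set.Ici 2)] (fun c : ℕ => (c : ℝ) ^ 2 * Real.log c) ∧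
      (∀ c : ℕ, 1 ≤ c →
        -- hybrid model, agents first (one message each), then one exchange with the curator
        (∃ P : HybridDP.Protocol (HybridDP.Point c (d c) (m c + 1)) (HybridDP.Bits c)
            [.agents, .curator] (m c) (n c),
          P.IsPrivate (1 / 4) ∧ P.AgentsIgnoreMessages ∧
            HybridDP.SolvesOneOutOfParity P (1 / 4)) ∧
        -- hybrid model, any number of exchanges with the curator, then one with the agents
        (∀ k : ℕ, ¬ ∃ P : HybridDP.Protocol (HybridDP.Point c (d c) (m c + 1)) (HybridDP.Bits c)
            (List.replicate k .curator ++ [.agents]) (m c) (n c),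
          P.IsPrivate (1 / 4) ∧ HybridDP.SolvesOneOutOfParity P (1 / 4)) ∧
        -- curator alone, with or without privacy
        (∀ k : ℕ, ¬ ∃ P : HybridDP.Protocol (HybridDP.Point c (d c) (m c + 1)) (HybridDP.Bits c)
            (List.replicate k .curator) (m c) 0,
          HybridDP.SolvesOneOutOfParity P (1 / 4))) ∧
      -- local model with `T` rounds
      (∃ γ : ℝ, 0 < γ ∧ ∀ᶠ c : ℕ in atTop, ∀ (T : ℕ)
        (P : HybridDP.Protocol (HybridDP.Point c (d c) (m c + 1)) (HybridDP.Bits c)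
            (List.replicate T .agents) 0 (n c)),
          P.IsPrivate (1 / 4) → HybridDP.SolvesOneOutOfParity P (1 / 4) →
            (2 : ℝ) ^ (γ * c) ≤ T ∧
            (2 : ℝ) ^ (γ * Real.sqrt (n c / Real.log (n c))) ≤ T) := by
  have hlog : ∀ c : ℕ, 2 ≤ c → 0 ≤ Real.log c := fun c _ => Real.log_natCast_nonneg c
  -- The factor `127` satisfies `2 * (35 / 36) ^ 127 ≤ 1 / 8`, as the curator needs. Then `n` is set
  -- by the decoding error, and `d` by the requirement `16 * (m + n) + 128 ≤ 2 ^ d`.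
  refine ⟨fun c => 3 * HybridDP.binaryLength c + 36, fun c => 127 * c,
    fun c => 2 ^ 31 * c ^ 2 * HybridDP.binaryLength c, ?_, ?_, ?_, fun c hc => ⟨?_, ?_, ?_⟩, ?_⟩
  · refine HybridDP.isTheta_principal_Ici_two 156 1 (fun c => by positivity) (fun c hc => ?_)
      (fun c hc => ?_) hlog
    · have h1 := HybridDP.binaryLength_le_log hc
      have h2 : (1 : ℝ) ≤ HybridDP.binaryLength c := by
        exact_mod_cast HybridDP.binaryLength_pos c
      push_cast
      linarith
    · have h1 := HybridDP.log_le_binaryLength hc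
      have h2 : (0 : ℝ) ≤ HybridDP.binaryLength c := Nat.cast_nonneg _
      push_cast
      linarith
  · refine HybridDP.isTheta_principal_Ici_two 127 1 (fun c => by positivity) (fun c hc => ?_)
      (fun c hc => ?_) fun c _ => Nat.cast_nonneg c
    · push_cast; exact le_rfl
    · push_cast; linarith [Nat.cast_nonneg (α := ℝ) c]
  · refine HybridDP.isTheta_principal_Ici_two (2 ^ 33) 1 (fun c => by positivity) (fun c hc => ?_)
      (fun c hc => ?_) fun c hc => mul_nonneg (by positivity) (hlog c hc)
    · have h1 := HybridDP.binaryLength_le_log hc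
      push_cast
      have : (2 : ℝ) ^ 31 * c ^ 2 * HybridDP.binaryLength c ≤
          2 ^ 31 * c ^ 2 * (4 * Real.log c) := by gcongr
      linarith
    · have h1 := HybridDP.log_le_binaryLength hc
      push_cast
      have h2 : (c : ℝ) ^ 2 * Real.log c ≤ c ^ 2 * HybridDP.binaryLength c := by gcongr
      have h3 : (0 : ℝ) ≤ c ^ 2 * HybridDP.binaryLength c := by positivity
      linarith
  · exact ⟨HybridDP.hybridProtocol _ _ _ _, HybridDP.hybridProtocol_isPrivate,
      HybridDP.hybridProtocol_agentsIgnoreMessages,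
      HybridDP.hybridProtocol_solves (HybridDP.two_pow_mul_pow_le hc)
        (HybridDP.decoding_error_le hc)⟩
  · rintro k ⟨P, hP, hsol⟩
    exact HybridDP.not_solves_of_curator_first hc (Nat.le_add_left_of_le (by norm_num))
      (HybridDP.samples_le_two_pow hc) P hP hsol
  · rintro k ⟨P, hsol⟩
    exact HybridDP.not_solves_of_curator_only hc (Nat.le_add_left_of_le (by norm_num)) P hsol
  · -- The lower bound on the number of agents holds for any number of rounds, so that `n c` agents
    -- are too few for large `c`.
    refine ⟨1, one_pos, ?_⟩
    filter_upwards [HybridDP.eventually_agents_le_two_pow] with c hc T P hP hsol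
    exact absurd hc (HybridDP.two_pow_lt_of_local P hP hsol).not_ge
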